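/- Let $l\ge 1$ be an integer. All functions are real-valued. Let $\dot H^l(\mathbb S^1)$ be the Sobolev space of $2\pi$-periodic functions with mean value zero, let $\|\cdot\|$ be the norm of $L_2(0,2\pi)$, and let $$c(l)=\bigl(2l\,\alpha^{\alpha}(1-\alpha)^{1-\alpha}\sin\pi\alpha\bigr)^{-1},\qquad \alpha=\frac1{2l}.$$ There is a largest constant $K(l)$ such that $$\|f\|_\infty^2\le c(l)\,\|f\|^{2-1/l}\,\|f^{(l)}\|^{1/l}-K(l)\,\|f\|^2\qquad\text{for all } f\in\dot H^l(\mathbb S^1),$$ and $K(l)>0$. Let $V\ge 0$ be a function in $L_{(2l+1)/(2l)}(0,2\pi)$, and let $A$ be the self-adjoint operator $$A\varphi=(-1)^l\frac{d^{2l}\varphi}{dx^{2l}}-\Pi(V\varphi),\qquad \Pi f=f-\frac1{2\pi}\int_0^{2\pi}f\,dx,$$ in the space of mean-zero functions in $L_2(0,2\pi)$, defined by the quadratic form $$\int_0^{2\pi}\varphi^{(l)}(x)^2\,dx-\int_0^{2\pi}V(x)\varphi(x)^2\,dx,\qquad \varphi\in\dot H^l(\mathbb S^1).$$ If $-\nu_1,\dots,-\nu_N\le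 0$ are eigenvalues of $A$, each repeated at most according to its multiplicity, then $$\sum_{j=1}^N\nu_j+N\Bigl(\frac{K(l)}{c(l)}\Bigr)^{2l}\le\frac{2l}{(2l+1)^{\frac{2l+1}{2l}}}\;c(l)\int_0^{2\pi}V(x)^{\frac{2l+1}{2l}}\,dx .$$ In particular, for $l=1$, $$\sum_{j=1}^N\nu_j+\frac N{\pi^2}\le\frac{2}{3\sqrt3}\int_0^{2\pi}V(x)^{3/2}\,dx .$$ -/

import Mathlib

open MeasureTheory Real

noncomputable section

namespace CircleLT

/-- Lebesgue measure on one period `(0, 2π]`. -/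
abbrev period : Measure ℝ := volume.restrict (Set.Ioc 0 (2 * π))

/-- The real Hilbert space `L₂(𝕊¹)` of square integrable `2π`-periodic functions, each
given by its values on one period. -/
abbrev L2 : Type := Lp ℝ 2 period

/-- `g` is the `k`-th weak derivative of `f` on the circle: the test functions are the smooth
`2π`-periodic functions on the line, so periodicity of `f` across the end points of the period
is part of the condition. -/
def IsWeakDeriv (k : ℕ) (f g : L2) : Prop :=
  ∀ ψ : ℝ → ℝ, ContDiff ℝ (⊤ : ℕ∞) ψ → Function.Periodic ψ (2 * π) →
    ∫ x, f x * iteratedDeriv k ψ x ∂period = (-1) ^ k * ∫ x, g x * ψ x ∂period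

/-- The Sobolev space `Ḣˡ(𝕊¹)`: mean value zero, and weak derivatives in `L₂` up to order `l`. -/
def SobolevZero (l : ℕ) : Set L2 :=
  {f | (∫ x, f x ∂period) = 0 ∧ ∀ k ≤ l, ∃ g : L2, IsWeakDeriv k f g}

open Classical in
/-- The `k`-th weak derivative `f⁽ᵏ⁾` (zero if there is none; weak derivatives are unique). -/
def weakDeriv (k : ℕ) (f : L2) : L2 :=
  if h : ∃ g : L2, IsWeakDeriv k f g then h.choose else 0

/-- The constant `c(l) = (2l α^α (1-α)^(1-α) sin πα)⁻¹` with `α = 1/(2l)`. -/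
def c (l : ℕ) : ℝ :=
  (2 * (l : ℝ) * (1 / (2 * (l : ℝ))) ^ (1 / (2 * (l : ℝ)))
    * (1 - 1 / (2 * (l : ℝ))) ^ (1 - 1 / (2 * (l : ℝ)))
    * sin (π * (1 / (2 * (l : ℝ)))))⁻¹

/-- All constants `κ` such that `‖f‖_∞² ≤ c(l) ‖f‖^(2-1/l) ‖f⁽ˡ⁾‖^(1/l) - κ ‖f‖²` for every
`f ∈ Ḣˡ(𝕊¹)`, with `L₂` norms on the right and the essential supremum on the left. -/
def admissible (l : ℕ) : Set ℝ :=
  {κ | ∀ f ∈ SobolevZero l, ∀ᵐ x ∂period,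
    f x ^ 2 ≤ c l * ‖f‖ ^ (2 - 1 / (l : ℝ)) * ‖weakDeriv l f‖ ^ (1 / (l : ℝ)) - κ * ‖f‖ ^ 2}

/-- The sharp constant `K(l)`, the largest admissible one. -/
def K (l : ℕ) : ℝ := sSup (admissible l)

/-- The bilinear form `∫ u⁽ˡ⁾ v⁽ˡ⁾ - ∫ V u v` of the Schrödinger type operator. -/
def form (l : ℕ) (V : ℝ → ℝ) (u v : L2) : ℝ :=
  (∫ x, weakDeriv l u x * weakDeriv l v x ∂period) - ∫ x, V x * (u x * v x) ∂period

/-- `u` is in the domain of the self-adjoint operator `A = (-1)ˡ d²ˡ/dx²ˡ - Π(V ·)` defined by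
the form on `Ḣˡ(𝕊¹)` in the Hilbert space of mean-zero functions, and `A u = w`. -/
def IsImage (l : ℕ) (V : ℝ → ℝ) (u w : L2) : Prop :=
  u ∈ SobolevZero l ∧ (∫ x, w x ∂period) = 0 ∧
    ∀ v ∈ SobolevZero l, form l V u v = ∫ x, w x * v x ∂period

/-- `u` is an eigenfunction of `A`, with eigenvalue `μ`. -/
def IsEigenfunction (l : ℕ) (V : ℝ → ℝ) (μ : ℝ) (u : L2) : Prop :=
  u ≠ 0 ∧ IsImage l V u (μ • u)

end CircleLT

end

noncomputable section

namespace CircleLT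

/-! Cauchy–Schwarz on the Fourier side gives, for mean-zero `f` and every `λ > 0`, `f(x)² ≤
(T(λ)/π)(‖f⁽ˡ⁾‖² + λ‖f‖²)` with `T(λ) = ∑_{k≥1} 1/(k^{2l} + λ)`. For `λ = μ^{2l}`, `μ^{2l} T` is `μ`
times a right-endpoint Riemann sum of mesh `1/μ` for `∫₀^∞ dx/(1 + x^{2l})`. The integrand
decreases, so the sum lies below the integral, by a margin bounded below for `μ ≥ 1`
(`exists_hasSum_le`). The optimal `λ` turns the integral into `c(l)` and the margin into a positive
admissible constant (`gap_admissible`). For `l = 1` the series is a hyperbolic cotangent, and a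
shifted `μ` yields `1/π`.

The spectral estimate uses this inequality for linear combinations of an orthonormal family `ψ_j`,
with coefficients `ψ_j(x)` taken at the very point `x`. With `ρ = ∑ ψ_j²` and `Q(x) = ‖∑ ψ_j(x)
ψ_j⁽ˡ⁾‖²` it becomes `ρ + K ≤ c (Q/ρ)^{1/(2l)}` where `ρ > 0`. Raising to the power `2l` and
integrating bounds `∫ ρ^{2l+1} + N K^{2l}` by `c^{2l} ∑ ‖ψ_j⁽ˡ⁾‖²` (`integral_density_pow_le`).
Young's inequality for `Vρ` cancels `∫ ρ^{2l+1}` and leaves a lower bound for the sum of the form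
over the family (`sum_form_ge`). On an orthonormal basis of the span of the eigenfunctions that sum
is the trace of `A`, namely `-∑ ν_j`. -/

/-! ### Fourier coefficients and weak derivatives -/

/-- The `n`-th Fourier coefficient of an element of `L₂(𝕊¹)`. -/
def fc (f : L2) (n : ℤ) : ℂ :=
  fourierCoeffOn Real.two_pi_pos (fun x => (f x : ℂ)) n

theorem fc_eq_integral (f : L2) (n : ℤ) :
    fc f n = (2 * π : ℂ)⁻¹ * ∫ x, (f x : ℂ) * Complex.exp (-(n * x * Complex.I)) ∂period := by
  rw [fc, fourierCoeffOn_eq_integral, intervalIntegral.integral_of_le Real.two_pi_pos.le]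
  have h : ∀ x : ℝ, fourier (-n) (x : AddCircle (2 * π - 0)) • (f x : ℂ)
      = (f x : ℂ) * Complex.exp (-(n * x * Complex.I)) := by
    intro x
    rw [fourier_coe_apply, smul_eq_mul, mul_comm]
    congr 2
    have : (π : ℂ) ≠ 0 := by exact_mod_cast Real.pi_ne_zero
    push_cast
    field_simp
    ring
  simp_rw [h]
  rw [Complex.real_smul]
  push_cast
  simp

theorem norm_sq_eq_integral (f : L2) : ‖f‖ ^ 2 = ∫ x, f x ^ 2 ∂period := by
  rw [← real_inner_self_eq_norm_sq, L2.inner_def]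
  simp [pow_two]

theorem inner_eq_integral (f g : L2) : inner ℝ f g = ∫ x, f x * g x ∂period := by
  rw [L2.inner_def]
  simp [mul_comm]

theorem memLp_ofReal (f : L2) : MemLp (fun x => (f x : ℂ)) 2 period :=
  (Lp.memLp f).ofReal

theorem hasSum_sq_fc (f : L2) : HasSum (fun n => ‖fc f n‖ ^ 2) ((2 * π)⁻¹ * ‖f‖ ^ 2) := by
  have h := hasSum_sq_fourierCoeffOn Real.two_pi_pos (memLp_ofReal f)
  rw [intervalIntegral.integral_of_le Real.two_pi_pos.le] at h
  rw [norm_sq_eq_integral]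
  simpa [fc] using h

theorem integrable_mul_exp (f : L2) (n : ℤ) :
    Integrable (fun x => (f x : ℂ) * Complex.exp (-(n * x * Complex.I))) period := by
  refine ((memLp_ofReal f).integrable (by norm_num)).mul_bdd (c := 1)
    (Continuous.aestronglyMeasurable (by fun_prop)) (ae_of_all _ fun x => ?_)
  have : (-(n * x * Complex.I) : ℂ) = ((-(n * x) : ℝ) : ℂ) * Complex.I := by push_cast; ring
  rw [this, Complex.norm_exp_ofReal_mul_I]

theorem eq_of_fc_eq {f g : L2} (h : ∀ n, fc f n = fc g n) : f = g := by
  have hsub : ∀ n, fc (f - g) n = 0 := by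
    intro n
    have h1 := fc_eq_integral f n
    have h2 := fc_eq_integral g n
    rw [fc_eq_integral]
    have : ∫ x, ((f - g : L2) x : ℂ) * Complex.exp (-(n * x * Complex.I)) ∂period
        = ∫ x, (f x : ℂ) * Complex.exp (-(n * x * Complex.I))
          - (g x : ℂ) * Complex.exp (-(n * x * Complex.I)) ∂period := by
      refine integral_congr_ae ?_
      filter_upwards [Lp.coeFn_sub f g] with x hx
      rw [hx]
      simp [sub_mul]
    rw [this, integral_sub (integrable_mul_exp f n) (integrable_mul_exp g n), mul_sub, ← h1, ← h2, h n, sub_self]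
  have h0 := hasSum_sq_fc (f - g)
  simp only [hsub, norm_zero, ne_eq, OfNat.ofNat_ne_zero, not_false_eq_true, zero_pow] at h0
  have h1 := h0.unique hasSum_zero
  have : ‖f - g‖ ^ 2 = 0 := by
    rcases mul_eq_zero.1 h1 with h | h
    · exact absurd h (by positivity)
    · exact h
  exact sub_eq_zero.1 (norm_eq_zero.1 (by simpa using this))

/-- The real trigonometric functions of frequency `n`, as a family of test functions stable under
differentiation. -/
def trig (n : ℤ) (z : ℂ) (x : ℝ) : ℝ := (z * Complex.exp (-(n * x * Complex.I))).re

theorem contDiff_trig (n : ℤ) (z : ℂ) : ContDiff ℝ (⊤ : ℕ∞) (trig n z) := by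
  have h : ContDiff ℝ (⊤ : ℕ∞) fun x : ℝ => z * Complex.exp (-(n * x * Complex.I)) := by
    have : ContDiff ℝ (⊤ : ℕ∞) fun x : ℝ => (x : ℂ) := Complex.ofRealCLM.contDiff
    fun_prop
  exact Complex.reCLM.contDiff.comp h

theorem periodic_trig (n : ℤ) (z : ℂ) : Function.Periodic (trig n z) (2 * π) := by
  intro x
  unfold trig
  congr 2
  rw [Complex.exp_eq_exp_iff_exists_int]
  refine ⟨-n, ?_⟩
  push_cast
  ring

theorem deriv_trig (n : ℤ) (z : ℂ) : deriv (trig n z) = trig n (-(n * Complex.I) * z) := by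
  funext x
  refine HasDerivAt.deriv ?_
  have h : HasDerivAt (fun y : ℂ => z * Complex.exp (-(n * y * Complex.I)))
      (-(n * Complex.I) * z * Complex.exp (-(n * x * Complex.I))) (x : ℂ) := by
    have h1 : HasDerivAt (fun y : ℂ => -(n * y * Complex.I)) (-(n * Complex.I)) (x : ℂ) := by
      have h2 := (((hasDerivAt_id (x : ℂ)).const_mul (n : ℂ)).mul_const Complex.I).neg
      rw [mul_one] at h2
      exact h2
    convert! (h1.cexp.const_mul z) using 1
    ring
  exact h.real_of_complex

theorem iteratedDeriv_trig (n : ℤ) (k : ℕ) (z : ℂ) :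
    iteratedDeriv k (trig n z) = trig n ((-(n * Complex.I)) ^ k * z) := by
  induction k generalizing z with
  | zero => simp
  | succ k ih => rw [iteratedDeriv_succ', deriv_trig, ih, pow_succ, mul_assoc]

theorem integral_mul_trig (f : L2) (n : ℤ) (z : ℂ) :
    ∫ x, f x * trig n z x ∂period = 2 * π * (z * fc f n).re := by
  have h : ∀ x, f x * trig n z x
      = RCLike.re (z * ((f x : ℂ) * Complex.exp (-(n * x * Complex.I)))) := by
    intro x
    have : z * ((f x : ℂ) * Complex.exp (-(n * x * Complex.I)))
      = (f x : ℂ) * (z * Complex.exp (-(n * x * Complex.I))) := by ring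
    rw [this, RCLike.re_eq_complex_re, Complex.re_ofReal_mul, trig]
  simp_rw [h]
  rw [integral_re ((integrable_mul_exp f n).const_mul z), integral_const_mul, fc_eq_integral]
  rw [RCLike.re_eq_complex_re, ← Complex.re_ofReal_mul]
  congr 1
  push_cast
  rw [mul_left_comm z, mul_inv_cancel_left₀ (by simp)]

/-- Test functions are real, so each test yields only one real part; letting the complex amplitude
`z` vary recovers the whole coefficient. -/
theorem IsWeakDeriv.fc_eq {k : ℕ} {f g : L2} (h : IsWeakDeriv k f g) (n : ℤ) :
    fc g n = (n * Complex.I) ^ k * fc f n := by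
  have key : ∀ z : ℂ, (z * fc g n).re = (z * ((n * Complex.I) ^ k * fc f n)).re := by
    intro z
    have h1 := h (trig n z) (contDiff_trig n z) (periodic_trig n z)
    rw [iteratedDeriv_trig, integral_mul_trig, integral_mul_trig] at h1
    have h2 : (-(n * Complex.I)) ^ k * z * fc f n
        = (((-1) ^ k : ℝ) : ℂ) * (z * ((n * Complex.I) ^ k * fc f n)) := by
      rw [neg_pow]; push_cast; ring
    rw [h2, Complex.re_ofReal_mul] at h1
    have h3 : ((-1 : ℝ)) ^ k ≠ 0 := by positivity
    have h4 : (-1 : ℝ) ^ k * (2 * π * (z * fc g n).re)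
        = (-1) ^ k * (2 * π * (z * ((n * Complex.I) ^ k * fc f n)).re) := by
      rw [← h1]; ring
    have := mul_left_cancel₀ h3 h4
    exact mul_left_cancel₀ (by positivity) this
  apply Complex.ext
  · simpa using key 1
  · have := key (-Complex.I)
    simpa using this

theorem IsWeakDeriv.unique {k : ℕ} {f g h : L2} (hg : IsWeakDeriv k f g)
    (hh : IsWeakDeriv k f h) : g = h :=
  eq_of_fc_eq fun n => by rw [hg.fc_eq, hh.fc_eq]

theorem isWeakDeriv_weakDeriv {k : ℕ} {f : L2} (h : ∃ g, IsWeakDeriv k f g) :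
    IsWeakDeriv k f (weakDeriv k f) := by
  rw [weakDeriv, dif_pos h]
  exact h.choose_spec

theorem IsWeakDeriv.weakDeriv_eq {k : ℕ} {f g : L2} (h : IsWeakDeriv k f g) :
    weakDeriv k f = g :=
  (isWeakDeriv_weakDeriv ⟨g, h⟩).unique h

/-! ### The Sobolev space as a linear space -/

theorem integrable_mul_continuous (f : L2) {ψ : ℝ → ℝ} (hψ : Continuous ψ) :
    Integrable (fun x => f x * ψ x) period := by
  obtain ⟨C, hC⟩ := (isCompact_Icc (a := (0 : ℝ)) (b := 2 * π)).exists_bound_of_continuousOn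
    hψ.continuousOn
  refine ((Lp.memLp f).integrable (by norm_num)).mul_bdd (c := C)
    hψ.aestronglyMeasurable ?_
  filter_upwards [ae_restrict_mem measurableSet_Ioc] with x hx
  exact hC x (Set.Ioc_subset_Icc_self hx)

theorem IsWeakDeriv.add {k : ℕ} {f g f' g' : L2} (hf : IsWeakDeriv k f f')
    (hg : IsWeakDeriv k g g') : IsWeakDeriv k (f + g) (f' + g') := by
  intro ψ hψ hp
  have hc : Continuous (iteratedDeriv k ψ) :=
    hψ.continuous_iteratedDeriv k (by exact_mod_cast le_top)
  have e : ∀ (u v : L2) {χ : ℝ → ℝ}, Continuous χ → ∫ x, (u + v : L2) x * χ x ∂period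
      = (∫ x, u x * χ x ∂period) + ∫ x, v x * χ x ∂period := by
    intro u v χ hχ
    rw [← integral_add (integrable_mul_continuous u hχ) (integrable_mul_continuous v hχ)]
    refine integral_congr_ae ?_
    filter_upwards [Lp.coeFn_add u v] with x hx
    rw [hx]
    simp [add_mul]
  rw [e _ _ hc, e _ _ hψ.continuous, hf ψ hψ hp, hg ψ hψ hp]
  ring

theorem IsWeakDeriv.smul {k : ℕ} {f f' : L2} (a : ℝ) (hf : IsWeakDeriv k f f') :
    IsWeakDeriv k (a • f) (a • f') := by
  intro ψ hψ hp
  have e : ∀ (u : L2) (χ : ℝ → ℝ), ∫ x, (a • u : L2) x * χ x ∂period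
      = a * ∫ x, u x * χ x ∂period := by
    intro u χ
    rw [← integral_const_mul]
    refine integral_congr_ae ?_
    filter_upwards [Lp.coeFn_smul a u] with x hx
    rw [hx]
    simp [mul_assoc]
  rw [e, e, hf ψ hψ hp]
  ring

theorem isWeakDeriv_zero (k : ℕ) : IsWeakDeriv k 0 0 := by
  have e : ∀ (χ : ℝ → ℝ), ∫ x, (0 : L2) x * χ x ∂period = 0 := by
    intro χ
    rw [← integral_zero ℝ ℝ (μ := period)]
    refine integral_congr_ae ?_
    filter_upwards [Lp.coeFn_zero ℝ 2 period] with x hx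
    rw [hx]
    simp
  intro ψ _ _
  rw [e, e, mul_zero]

/-- `Ḣˡ(𝕊¹)` as a subspace of `L₂(𝕊¹)`. -/
def sobolevSubmodule (l : ℕ) : Submodule ℝ L2 where
  carrier := SobolevZero l
  add_mem' := by
    intro f g hf hg
    refine ⟨?_, fun k hk => ?_⟩
    · rw [integral_congr_ae (Lp.coeFn_add f g)]
      simp only [Pi.add_apply]
      rw [integral_add ((Lp.memLp f).integrable (by norm_num))
        ((Lp.memLp g).integrable (by norm_num)), hf.1, hg.1, add_zero]
    · obtain ⟨f', hf'⟩ := hf.2 k hk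
      obtain ⟨g', hg'⟩ := hg.2 k hk
      exact ⟨_, hf'.add hg'⟩
  zero_mem' := by
    refine ⟨?_, fun k _ => ⟨0, isWeakDeriv_zero k⟩⟩
    rw [integral_congr_ae (Lp.coeFn_zero ℝ 2 period)]
    simp
  smul_mem' := by
    intro a f hf
    refine ⟨?_, fun k hk => ?_⟩
    · rw [integral_congr_ae (Lp.coeFn_smul a f)]
      simp only [Pi.smul_apply]
      rw [integral_smul, hf.1, smul_zero]
    · obtain ⟨f', hf'⟩ := hf.2 k hk
      exact ⟨_, hf'.smul a⟩

theorem SobolevZero.isWeakDeriv {l : ℕ} {f : L2} (hf : f ∈ SobolevZero l) :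
    IsWeakDeriv l f (weakDeriv l f) :=
  isWeakDeriv_weakDeriv (hf.2 l le_rfl)

/-- The `l`-th weak derivative as a linear map on `Ḣˡ(𝕊¹)`. -/
def derivLinear (l : ℕ) : sobolevSubmodule l →ₗ[ℝ] L2 where
  toFun f := weakDeriv l f
  map_add' f g :=
    ((SobolevZero.isWeakDeriv f.2).add (SobolevZero.isWeakDeriv g.2)).weakDeriv_eq
  map_smul' a f := ((SobolevZero.isWeakDeriv f.2).smul a).weakDeriv_eq

theorem derivLinear_apply {l : ℕ} (f : sobolevSubmodule l) :
    derivLinear l f = weakDeriv l f := rfl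

/-! ### The pointwise bound from Fourier series -/

/-- The series converges uniformly to a continuous `G` and in `L₂` to `f`; uniqueness of the `L₂`
limit gives `f = G` almost everywhere. -/
theorem ae_abs_le_tsum_norm_fc (f : L2) (hs : Summable fun n => ‖fc f n‖) :
    ∀ᵐ x ∂period, |f x| ≤ ∑' n, ‖fc f n‖ := by
  have hT : Fact (0 < 2 * π) := ⟨Real.two_pi_pos⟩
  have hm : MemLp (fun x => (f x : ℂ)) 2 (volume.restrict (Set.Ioc 0 (0 + 2 * π))) := by
    rw [zero_add]; exact memLp_ofReal f
  have h := hm.memLp_liftIoc.haarAddCircle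
  have hfc : ∀ n, fourierCoeff (h.toLp) n = fc f n := by
    intro n
    rw [fourierCoeff_congr_ae h.coeFn_toLp, fourierCoeff_liftIoc_eq, fc]
    simp [fourierCoeffOn_eq_integral]
  have hs' : Summable fun n : ℤ => (fc f n) • (fourier n : C(AddCircle (2 * π), ℂ)) := by
    refine Summable.of_norm ?_
    simpa only [norm_smul, fourier_norm, mul_one] using hs
  obtain ⟨G, hG⟩ := hs'
  have hGn : ‖G‖ ≤ ∑' n, ‖fc f n‖ := by
    rw [← hG.tsum_eq]
    refine tsum_of_norm_bounded hs.hasSum fun n => ?_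
    rw [norm_smul, fourier_norm, mul_one]
  have h1 := hasSum_fourier_series_L2 h.toLp
  have h2 := hG.mapL (ContinuousMap.toLp (E := ℂ) 2 AddCircle.haarAddCircle ℂ)
  simp only [hfc] at h1
  simp only [map_smul] at h2
  have h3 := h1.unique h2
  have h4 : ∀ᵐ t ∂(AddCircle.haarAddCircle (T := 2 * π)),
      ‖AddCircle.liftIoc (2 * π) 0 (fun x => (f x : ℂ)) t‖ ≤ ∑' n, ‖fc f n‖ := by
    have h5 : (h.toLp : AddCircle (2 * π) → ℂ) =ᵐ[AddCircle.haarAddCircle] G := by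
      rw [h3]; exact ContinuousMap.coeFn_toLp _ _
    filter_upwards [h.coeFn_toLp, h5] with t ht1 ht2
    rw [← ht1, ht2]
    exact (G.norm_coe_le_norm t).trans hGn
  have h6 : ∀ᵐ t ∂(volume : Measure (AddCircle (2 * π))),
      ‖AddCircle.liftIoc (2 * π) 0 (fun x => (f x : ℂ)) t‖ ≤ ∑' n, ‖fc f n‖ := by
    rw [AddCircle.volume_eq_smul_haarAddCircle]
    exact Measure.ae_smul_measure h4 _
  have h7 := (AddCircle.measurePreserving_mk (2 * π) 0).quasiMeasurePreserving.ae h6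
  rw [zero_add] at h7
  filter_upwards [h7, ae_restrict_mem measurableSet_Ioc] with x hx hxm
  rw [AddCircle.liftIoc_coe_apply (by rwa [zero_add])] at hx
  simpa using hx

theorem SobolevZero.fc_zero {l : ℕ} {f : L2} (hf : f ∈ SobolevZero l) : fc f 0 = 0 := by
  rw [fc_eq_integral]
  simp only [Int.cast_zero, zero_mul, neg_zero, Complex.exp_zero, mul_one]
  rw [integral_complex_ofReal, hf.1]
  simp

theorem SobolevZero.hasSum_weakDeriv {l : ℕ} {f : L2} (hf : f ∈ SobolevZero l) :
    HasSum (fun n : ℤ => (n : ℝ) ^ (2 * l) * ‖fc f n‖ ^ 2)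
      ((2 * π)⁻¹ * ‖weakDeriv l f‖ ^ 2) := by
  have h := hasSum_sq_fc (weakDeriv l f)
  convert! h using 2 with n
  rw [(SobolevZero.isWeakDeriv hf).fc_eq, norm_mul, norm_pow, norm_mul, Complex.norm_I,
    Complex.norm_intCast, mul_pow, mul_one, ← pow_mul, mul_comm l 2, pow_mul, pow_mul, sq_abs]

theorem one_le_intCast_pow {n : ℤ} (hn : n ≠ 0) (l : ℕ) : (1 : ℝ) ≤ (n : ℝ) ^ (2 * l) := by
  rw [pow_mul]
  refine one_le_pow₀ ?_
  have : (1 : ℤ) ≤ n ^ 2 := Int.add_one_le_iff.2 (sq_pos_of_ne_zero hn)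
  exact_mod_cast this

/-- Wirtinger's inequality: the zero mode vanishes and every other frequency has modulus at least
one. It later keeps the parameter `μ` in the range where the Riemann sums are controlled. -/
theorem SobolevZero.norm_le_norm_weakDeriv {l : ℕ} {f : L2} (hf : f ∈ SobolevZero l) :
    ‖f‖ ≤ ‖weakDeriv l f‖ := by
  have h := hasSum_le (fun n => ?_) (hasSum_sq_fc f) (SobolevZero.hasSum_weakDeriv hf)
  · have h' := le_of_mul_le_mul_left h (by positivity)
    exact le_of_sq_le_sq h' (norm_nonneg _)
  · by_cases hn : n = 0
    · subst hn; simp [SobolevZero.fc_zero hf]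
    · exact le_mul_of_one_le_left (by positivity) (one_le_intCast_pow hn l)

/-- Cauchy–Schwarz for `∑ |f̂(n)|` with weights `n^{2l} + λ`, followed by Parseval. -/
theorem SobolevZero.ae_sq_le {l : ℕ} {f : L2} (hf : f ∈ SobolevZero l) {lam T : ℝ}
    (hlam : 0 < lam)
    (hT : HasSum (fun k : ℕ => 1 / (((k : ℝ) + 1) ^ (2 * l) + lam)) T) :
    ∀ᵐ x ∂period, f x ^ 2 ≤ T / π * (‖weakDeriv l f‖ ^ 2 + lam * ‖f‖ ^ 2) := by
  have hw : ∀ n : ℤ, 0 < (n : ℝ) ^ (2 * l) + lam := by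
    intro n
    have : 0 ≤ (n : ℝ) ^ (2 * l) := by rw [pow_mul]; positivity
    linarith
  -- The weight at `n = 0` is dropped because the mean is zero; the frequencies `±k` then give `2T`.
  set b : ℤ → ℝ := fun n => if n = 0 then 0 else 1 / ((n : ℝ) ^ (2 * l) + lam) with hb
  have hbs : HasSum b (2 * T) := by
    have h1 : HasSum b (T + b 0 + T) := by
      refine HasSum.of_add_one_of_neg_add_one ?_ ?_
      · convert! hT using 2 with k
        rw [hb]
        have : (k : ℤ) + 1 ≠ 0 := by omega
        simp [this]
      · convert! hT using 2 with k
        rw [hb]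
        have : -((k : ℤ) + 1) ≠ 0 := by omega
        simp only [this, if_false]
        push_cast
        rw [pow_mul, neg_sq, ← pow_mul]
    have : T + b 0 + T = 2 * T := by simp [hb]; ring
    rwa [this] at h1
  have hE : HasSum (fun n : ℤ => ((n : ℝ) ^ (2 * l) + lam) * ‖fc f n‖ ^ 2)
      ((2 * π)⁻¹ * (‖weakDeriv l f‖ ^ 2 + lam * ‖f‖ ^ 2)) := by
    have := (SobolevZero.hasSum_weakDeriv hf).add ((hasSum_sq_fc f).mul_left lam)
    convert! this using 1
    · funext n; ring
    · ring
  have hbn : ∀ n, 0 ≤ b n := by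
    intro n; rw [hb]; dsimp only; split_ifs
    · exact le_rfl
    · have := hw n; positivity
  have hsplit : ∀ n, ‖fc f n‖ = √(b n) * √(((n : ℝ) ^ (2 * l) + lam) * ‖fc f n‖ ^ 2) := by
    intro n
    by_cases hn : n = 0
    · subst hn; simp [SobolevZero.fc_zero hf]
    · rw [← Real.sqrt_mul (hbn n)]
      have : b n * (((n : ℝ) ^ (2 * l) + lam) * ‖fc f n‖ ^ 2) = ‖fc f n‖ ^ 2 := by
        rw [hb]; have := (hw n).ne'; simp only [hn, if_false]; field_simp
      rw [this, Real.sqrt_sq (norm_nonneg _)]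
  have hpq : (2 : ℝ).HolderConjugate 2 := by
    rw [Real.holderConjugate_iff]; norm_num
  have hCS := Real.summable_and_inner_le_Lp_mul_Lq_tsum_of_nonneg hpq
    (f := fun n => √(b n)) (g := fun n : ℤ => √(((n : ℝ) ^ (2 * l) + lam) * ‖fc f n‖ ^ 2))
    (fun n => Real.sqrt_nonneg _) (fun n => Real.sqrt_nonneg _)
    (by simpa [Real.sq_sqrt (hbn _)] using hbs.summable)
    (by
      have : ∀ n : ℤ, √(((n : ℝ) ^ (2 * l) + lam) * ‖fc f n‖ ^ 2) ^ (2 : ℝ)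
        = ((n : ℝ) ^ (2 * l) + lam) * ‖fc f n‖ ^ 2 := by
        intro n
        rw [Real.rpow_ofNat, Real.sq_sqrt (mul_nonneg (hw n).le (by positivity))]
      simpa only [this] using hE.summable)
  simp only [← hsplit] at hCS
  obtain ⟨hs, hle⟩ := hCS
  have e1 : ∑' n : ℤ, √(b n) ^ (2 : ℝ) = 2 * T := by
    rw [← hbs.tsum_eq]
    refine tsum_congr fun n => ?_
    rw [Real.rpow_ofNat, Real.sq_sqrt (hbn n)]
  have e2 : ∑' n : ℤ, √(((n : ℝ) ^ (2 * l) + lam) * ‖fc f n‖ ^ 2) ^ (2 : ℝ)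
      = (2 * π)⁻¹ * (‖weakDeriv l f‖ ^ 2 + lam * ‖f‖ ^ 2) := by
    rw [← hE.tsum_eq]
    refine tsum_congr fun n => ?_
    rw [Real.rpow_ofNat, Real.sq_sqrt (mul_nonneg (hw n).le (by positivity))]
  rw [e1, e2] at hle
  have hT0 : 0 ≤ 2 * T := hbs.nonneg hbn
  filter_upwards [ae_abs_le_tsum_norm_fc f hs] with x hx
  have hx' := hx.trans hle
  rw [← Real.sqrt_eq_rpow, ← Real.sqrt_eq_rpow, ← Real.sqrt_mul hT0] at hx'
  have hnn : 0 ≤ 2 * T * ((2 * π)⁻¹ * (‖weakDeriv l f‖ ^ 2 + lam * ‖f‖ ^ 2)) :=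
    mul_nonneg hT0 (by positivity)
  have h2 := (Real.le_sqrt (abs_nonneg _) hnn).1 hx'
  rw [sq_abs] at h2
  calc f x ^ 2 ≤ _ := h2
    _ = _ := by field_simp

/-! ### The integral of `1 / (1 + x ^ p)` over the half-line -/

theorem integrableOn_of_integral_pos {f : ℝ → ℝ} {s : Set ℝ} (h : 0 < ∫ x in s, f x) :
    IntegrableOn f s := by
  by_contra hf
  rw [integral_undef hf] at h
  exact lt_irrefl _ h

theorem lintegral_eq_of_integral_eq {f : ℝ → ℝ} {s : Set ℝ} (hs : MeasurableSet s) {a : ℝ}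
    (ha : 0 < a) (hf : ∀ x ∈ s, 0 ≤ f x) (h : ∫ x in s, f x = a) :
    ∫⁻ x in s, ENNReal.ofReal (f x) = ENNReal.ofReal a := by
  rw [← h, ofReal_integral_eq_lintegral_ofReal]
  · exact integrableOn_of_integral_pos (h ▸ ha)
  · filter_upwards [ae_restrict_mem hs] with x hx using hf x hx

/-- Write the integrand as `∫₀^∞ exp(-(1 + x^p) t) dt` and swap by Tonelli. The result is `Γ(1 +
1/p) Γ(1 - 1/p)`, evaluated by the reflection formula. -/
theorem lintegral_one_div_one_add_rpow {p : ℝ} (hp : 1 < p) :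
    ∫⁻ x in Set.Ioi (0 : ℝ), ENNReal.ofReal (1 / (1 + x ^ p))
      = ENNReal.ofReal (π * (1 / p) / sin (π * (1 / p))) := by
  have hp0 : 0 < p := by linarith
  have hα : 0 < 1 / p := by positivity
  have hα1 : 1 / p < 1 := by rw [div_lt_one hp0]; exact hp
  have h1 : ∀ x ∈ Set.Ioi (0 : ℝ), ENNReal.ofReal (1 / (1 + x ^ p))
      = ∫⁻ t in Set.Ioi (0 : ℝ), ENNReal.ofReal (exp (-(1 + x ^ p) * t)) := by
    intro x hx
    have hx' : 0 < 1 + x ^ p := by have := rpow_pos_of_pos hx p; linarith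
    refine (lintegral_eq_of_integral_eq measurableSet_Ioi (by positivity)
      (fun _ _ => (exp_pos _).le) ?_).symm
    have := integral_exp_neg_mul_rpow (p := 1) one_pos hx'
    simp only [rpow_one] at this
    rw [this, show (1 : ℝ) / 1 + 1 = 2 by norm_num, show (-1 : ℝ) / 1 = -1 by norm_num,
      Gamma_two, rpow_neg_one, mul_one, one_div]
  have h2 : ∀ t ∈ Set.Ioi (0 : ℝ),
      ∫⁻ x in Set.Ioi (0 : ℝ), ENNReal.ofReal (exp (-(1 + x ^ p) * t))
        = ENNReal.ofReal (t ^ (-(1 / p)) * exp (-1 * t ^ (1 : ℝ)) * Gamma (1 / p + 1)) := by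
    intro t ht
    have ht' : 0 < t := ht
    have := integral_exp_neg_mul_rpow hp0 ht'
    refine lintegral_eq_of_integral_eq measurableSet_Ioi ?_
      (fun _ _ => (exp_pos _).le) ?_
    · have := Gamma_pos_of_pos (show 0 < 1 / p + 1 by linarith)
      have := rpow_pos_of_pos ht' (-(1 / p))
      positivity
    · have e : ∀ x : ℝ, exp (-(1 + x ^ p) * t) = exp (-t) * exp (-t * x ^ p) := by
        intro x; rw [← exp_add]; ring_nf
      simp_rw [e]
      rw [integral_const_mul, this, rpow_one, neg_div]
      ring_nf
  rw [setLIntegral_congr_fun measurableSet_Ioi h1, lintegral_lintegral_swap,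
    setLIntegral_congr_fun measurableSet_Ioi h2]
  · refine lintegral_eq_of_integral_eq measurableSet_Ioi ?_ ?_ ?_
    · have : 0 < sin (π * (1 / p)) :=
        sin_pos_of_pos_of_lt_pi (by positivity) (by nlinarith [pi_pos])
      positivity
    · intro t ht
      have := Gamma_pos_of_pos (show 0 < 1 / p + 1 by linarith)
      have := rpow_pos_of_pos (show 0 < t from ht) (-(1 / p))
      positivity
    · rw [integral_mul_const, integral_rpow_mul_exp_neg_mul_rpow one_pos (by linarith) one_pos,
        one_rpow, Gamma_add_one hα.ne', mul_div_right_comm, ← Gamma_mul_Gamma_one_sub]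
      rw [show (-(1 / p) + 1) / 1 = 1 - 1 / p by ring]
      ring
  · refine Measurable.aemeasurable ?_
    unfold Function.uncurry
    fun_prop

/-- The integral of `1 / (1 + x ^ (2 l))` over the half-line. -/
def halfLineIntegral (l : ℕ) : ℝ :=
  π * (1 / (2 * (l : ℝ))) / sin (π * (1 / (2 * (l : ℝ))))

theorem sin_pi_div_pos {l : ℕ} (hl : 1 ≤ l) : 0 < sin (π * (1 / (2 * (l : ℝ)))) := by
  have hl' : (1 : ℝ) ≤ l := by exact_mod_cast hl
  refine sin_pos_of_pos_of_lt_pi (by positivity) ?_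
  have : 1 / (2 * (l : ℝ)) < 1 := by rw [div_lt_one (by positivity)]; linarith
  nlinarith [pi_pos]

theorem lintegral_one_div_one_add_pow {l : ℕ} (hl : 1 ≤ l) :
    ∫⁻ x in Set.Ioi (0 : ℝ), ENNReal.ofReal (1 / (1 + x ^ (2 * l)))
      = ENNReal.ofReal (halfLineIntegral l) := by
  have hl' : (1 : ℝ) ≤ l := by exact_mod_cast hl
  rw [halfLineIntegral, ← lintegral_one_div_one_add_rpow (by linarith : 1 < 2 * (l : ℝ))]
  refine lintegral_congr fun x => ?_
  rw [← rpow_natCast]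
  push_cast
  rfl

theorem one_add_pow_pos (l : ℕ) (x : ℝ) : 0 < 1 + x ^ (2 * l) := by
  rw [pow_mul]; positivity

theorem continuous_one_div_one_add_pow (l : ℕ) :
    Continuous fun x : ℝ => 1 / (1 + x ^ (2 * l)) :=
  continuous_const.div (by fun_prop) fun x => (one_add_pow_pos l x).ne'

theorem halfLineIntegral_pos {l : ℕ} (hl : 1 ≤ l) : 0 < halfLineIntegral l := by
  have hl' : (1 : ℝ) ≤ l := by exact_mod_cast hl
  have := sin_pi_div_pos hl
  rw [halfLineIntegral]
  positivity

theorem intervalIntegral_le_halfLineIntegral {l : ℕ} (hl : 1 ≤ l) {R : ℝ} (hR : 0 ≤ R) :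
    ∫ x in (0 : ℝ)..R, 1 / (1 + x ^ (2 * l)) ≤ halfLineIntegral l := by
  have hc := continuous_one_div_one_add_pow l
  have hnn : ∀ x : ℝ, 0 ≤ 1 / (1 + x ^ (2 * l)) := fun x => by
    have := one_add_pow_pos l x; positivity
  rw [intervalIntegral.integral_of_le hR,
    integral_eq_lintegral_of_nonneg_ae (ae_of_all _ hnn) hc.aestronglyMeasurable]
  refine ENNReal.toReal_le_of_le_ofReal (halfLineIntegral_pos hl).le ?_
  rw [← lintegral_one_div_one_add_pow hl]
  exact lintegral_mono_set Set.Ioc_subset_Ioi_self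

/-! ### Riemann sums and their distance from the integral -/

theorem sum_range_two_mul (g : ℕ → ℝ) (n : ℕ) :
    ∑ i ∈ Finset.range (2 * n), g i = ∑ k ∈ Finset.range n, (g (2 * k) + g (2 * k + 1)) := by
  induction n with
  | zero => simp
  | succ n ih =>
    rw [Finset.sum_range_succ, ← ih, show 2 * (n + 1) = 2 * n + 1 + 1 by ring,
      Finset.sum_range_succ, Finset.sum_range_succ, add_assoc]

/-- A right-endpoint sum of a decreasing function with steps half as long; its terms pair up as
midpoint and endpoint of each full step. -/
theorem sum_half_steps_le {l : ℕ} (hl : 1 ≤ l) {μ : ℝ} (hμ : 0 < μ) (n : ℕ) :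
    ∑ k ∈ Finset.range n, (1 / (1 + (((k : ℝ) + 1 / 2) / μ) ^ (2 * l))
      + 1 / (1 + (((k : ℝ) + 1) / μ) ^ (2 * l))) ≤ 2 * μ * halfLineIntegral l := by
  set g : ℝ → ℝ := fun x => 1 / (1 + (x / (2 * μ)) ^ (2 * l)) with hg
  have hanti : AntitoneOn g (Set.Icc 0 (0 + (2 * n : ℕ))) := by
    intro x hx y hy hxy
    rw [hg]
    have h1 : 0 ≤ x / (2 * μ) := div_nonneg hx.1 (by positivity)
    have h2 := one_add_pow_pos l (x / (2 * μ))
    dsimp only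
    gcongr
  have h := hanti.sum_le_integral
  rw [sum_range_two_mul, zero_add] at h
  have e : ∫ x in (0 : ℝ)..(2 * n : ℕ), g x
      = 2 * μ * ∫ x in (0 : ℝ)..((2 * n : ℕ) : ℝ) / (2 * μ), 1 / (1 + x ^ (2 * l)) := by
    have := intervalIntegral.integral_comp_div (a := 0) (b := ((2 * n : ℕ) : ℝ))
      (fun x : ℝ => 1 / (1 + x ^ (2 * l))) (show 2 * μ ≠ 0 by positivity)
    rw [zero_div, smul_eq_mul] at this
    exact this
  rw [e] at h
  refine le_trans (le_of_eq ?_) (h.trans ?_)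
  · refine Finset.sum_congr rfl fun k _ => ?_
    rw [hg]
    push_cast
    congr 4 <;> field_simp <;> ring
  · exact mul_le_mul_of_nonneg_left (intervalIntegral_le_halfLineIntegral hl (by positivity))
      (by positivity)

/-- On this block the points stay below `4` and the right one is at least `1`. Hence the powers
differ by at least a fraction `1/(2(k+1))` of the larger one, while the denominators stay bounded.
-/
theorem one_div_sub_one_div_ge {l : ℕ} (hl : 1 ≤ l) {μ : ℝ} (hμ : 1 ≤ μ) {m k : ℕ}
    (hm : μ ≤ m) (hm' : (m : ℝ) ≤ 2 * μ) (hk : m ≤ k) (hk' : k < 2 * m) :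
    1 / (4 * m * (1 + 4 ^ (2 * l)) ^ 2) ≤ 1 / (1 + (((k : ℝ) + 1 / 2) / μ) ^ (2 * l))
      - 1 / (1 + (((k : ℝ) + 1) / μ) ^ (2 * l)) := by
  have hμ0 : 0 < μ := by linarith
  have hm0 : (0 : ℝ) < m := by linarith
  have hkm : (m : ℝ) ≤ k := by exact_mod_cast hk
  have hkm' : (k : ℝ) + 1 ≤ 2 * m := by exact_mod_cast hk'
  obtain ⟨j, rfl⟩ : ∃ j, l = j + 1 := ⟨l - 1, by omega⟩
  set y : ℝ := ((k : ℝ) + 1) / μ with hy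
  set z : ℝ := ((k : ℝ) + 1 / 2) / μ with hz
  have hy1 : 1 ≤ y := by rw [hy, le_div_iff₀ hμ0]; linarith
  have hy4 : y ≤ 4 := by rw [hy, div_le_iff₀ hμ0]; linarith
  have hz0 : 0 ≤ z := by rw [hz]; positivity
  have hzy : z ≤ y := by rw [hy, hz]; gcongr; norm_num
  set b := y ^ (2 * (j + 1)) with hb
  set a := z ^ (2 * (j + 1)) with ha
  have hb1 : 1 ≤ b := one_le_pow₀ hy1
  have hb4 : b ≤ 4 ^ (2 * (j + 1)) := by rw [hb]; gcongr
  have ha0 : 0 ≤ a := by positivity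
  have hab : a ≤ b := by rw [ha, hb]; gcongr
  have hdiff : 1 / (4 * m) ≤ b - a := by
    have e1 : a ≤ z * y ^ (2 * j + 1) := by
      rw [ha, show 2 * (j + 1) = (2 * j + 1) + 1 by ring, pow_succ, mul_comm]
      gcongr
    have e2 : b = y * y ^ (2 * j + 1) := by
      rw [hb, show 2 * (j + 1) = (2 * j + 1) + 1 by ring, pow_succ, mul_comm]
    have e3 : z = y * (1 - 1 / (2 * (k + 1))) := by
      rw [hy, hz]; field_simp; ring
    have e4 : b * (1 / (2 * (k + 1))) ≤ b - a := by
      rw [e3] at e1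
      have : y * (1 - 1 / (2 * ((k : ℝ) + 1))) * y ^ (2 * j + 1)
        = b - b * (1 / (2 * (k + 1))) := by rw [e2]; ring
      linarith
    refine le_trans ?_ e4
    have : 1 / (4 * (m : ℝ)) ≤ 1 / (2 * (k + 1)) := by
      apply one_div_le_one_div_of_le (by positivity); linarith
    refine this.trans ?_
    exact le_mul_of_one_le_left (by positivity) hb1
  have e : 1 / (1 + a) - 1 / (1 + b) = (b - a) / ((1 + a) * (1 + b)) := by
    have : 1 + a ≠ 0 := by positivity
    have : 1 + b ≠ 0 := by positivity
    field_simp; ring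
  rw [e, ← div_div]
  have hba : 0 ≤ b - a := by linarith
  have hb' : 0 < 1 + b := by linarith
  calc 1 / (4 * (m : ℝ)) / (1 + 4 ^ (2 * (j + 1))) ^ 2
      ≤ (b - a) / (1 + 4 ^ (2 * (j + 1))) ^ 2 := by gcongr
    _ ≤ (b - a) / ((1 + a) * (1 + b)) := by
      rw [pow_two]
      gcongr
      linarith

/-- A lower bound for the error of the right-endpoint Riemann sums of `1 / (1 + x ^ (2 l))`. -/
def gap (l : ℕ) : ℝ := 1 / (8 * (1 + 4 ^ (2 * l)) ^ 2)

theorem gap_pos (l : ℕ) : 0 < gap l := by rw [gap]; positivity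

/-- Let `S` be the endpoint sum and `S'` the midpoint sum. The half-step bound controls `S + S'`,
and the `m` terms of the block `m ≤ k < 2m` give `S' - S ≥ 2 gap`; subtraction bounds `2S`. -/
theorem sum_one_div_le {l : ℕ} (hl : 1 ≤ l) {μ : ℝ} (hμ : 1 ≤ μ) (n : ℕ) :
    ∑ k ∈ Finset.range n, 1 / (1 + (((k : ℝ) + 1) / μ) ^ (2 * l))
      ≤ μ * halfLineIntegral l - gap l := by
  have hμ0 : 0 < μ := by linarith
  set m := ⌈μ⌉₊ with hm
  have hm1 : μ ≤ m := Nat.le_ceil μ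
  have hm2 : (m : ℝ) ≤ 2 * μ := by
    have := Nat.ceil_lt_add_one hμ0.le
    linarith
  have hm0 : (0 : ℝ) < m := by linarith
  set g : ℕ → ℝ := fun k => 1 / (1 + (((k : ℝ) + 1) / μ) ^ (2 * l)) with hg
  set g' : ℕ → ℝ := fun k => 1 / (1 + (((k : ℝ) + 1 / 2) / μ) ^ (2 * l)) with hg'
  have hgn : ∀ k, 0 ≤ g k := fun k => by
    have := one_add_pow_pos l (((k : ℝ) + 1) / μ)
    rw [hg]; positivity
  have hgg : ∀ k, 0 ≤ g' k - g k := by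
    intro k
    have := one_add_pow_pos l (((k : ℝ) + 1 / 2) / μ)
    rw [hg, hg', sub_nonneg]
    dsimp only
    gcongr
    norm_num
  -- All terms are nonnegative, so the range may be enlarged to contain the block.
  set M := max n (2 * m)
  have h1 : ∑ k ∈ Finset.range n, g k ≤ ∑ k ∈ Finset.range M, g k :=
    Finset.sum_le_sum_of_subset_of_nonneg
      (Finset.range_subset_range.2 (le_max_left _ _)) fun k _ _ => hgn k
  have h2 : 2 * gap l ≤ ∑ k ∈ Finset.range M, (g' k - g k) := by
    calc 2 * gap l = ∑ k ∈ Finset.Ico m (2 * m), 1 / (4 * (m : ℝ) * (1 + 4 ^ (2 * l)) ^ 2) := by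
          rw [Finset.sum_const, Nat.card_Ico, nsmul_eq_mul, gap,
            show 2 * m - m = m by omega]
          field_simp
          norm_num
      _ ≤ ∑ k ∈ Finset.Ico m (2 * m), (g' k - g k) := by
          refine Finset.sum_le_sum fun k hk => ?_
          rw [Finset.mem_Ico] at hk
          exact one_div_sub_one_div_ge hl hμ hm1 hm2 hk.1 hk.2
      _ ≤ _ := by
          refine Finset.sum_le_sum_of_subset_of_nonneg ?_ fun k _ _ => hgg k
          intro k hk
          rw [Finset.mem_Ico] at hk
          exact Finset.mem_range.2 (hk.2.trans_le (le_max_right _ _))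
  have h3 : ∑ k ∈ Finset.range M, (g' k + g k) ≤ 2 * μ * halfLineIntegral l :=
    sum_half_steps_le hl hμ0 M
  rw [Finset.sum_sub_distrib] at h2
  rw [Finset.sum_add_distrib] at h3
  linarith

theorem exists_hasSum_le {l : ℕ} (hl : 1 ≤ l) {μ : ℝ} (hμ : 1 ≤ μ) :
    ∃ T, HasSum (fun k : ℕ => 1 / (((k : ℝ) + 1) ^ (2 * l) + μ ^ (2 * l))) T ∧
      μ ^ (2 * l) * T ≤ μ * halfLineIntegral l - gap l := by
  have hμ0 : 0 < μ := by linarith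
  set g : ℕ → ℝ := fun k => 1 / (1 + (((k : ℝ) + 1) / μ) ^ (2 * l)) with hg
  have hgn : ∀ k, 0 ≤ g k := fun k => by
    have := one_add_pow_pos l (((k : ℝ) + 1) / μ)
    rw [hg]; positivity
  have hs : Summable g := summable_of_sum_range_le hgn (sum_one_div_le hl hμ)
  have hle := hs.tsum_le_of_sum_range_le (sum_one_div_le hl hμ)
  refine ⟨(μ ^ (2 * l))⁻¹ * ∑' k, g k, ?_, ?_⟩
  · convert! hs.hasSum.mul_left (μ ^ (2 * l))⁻¹ using 2 with k
    rw [hg]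
    dsimp only
    rw [div_pow]
    field_simp
    ring
  · rw [mul_inv_cancel_left₀ (by positivity)]
    exact hle

/-! ### The series in closed form for `l = 1` -/

/-- The partial fraction expansion of the cotangent at the point `iμ`. -/
theorem hasSum_one_div_sq_add_sq {μ : ℝ} (hμ0 : 0 < μ) :
    HasSum (fun k : ℕ => 1 / (((k : ℝ) + 1) ^ (2 * 1) + μ ^ 2))
      ((π * μ * (cosh (π * μ) / sinh (π * μ)) - 1) / (2 * μ ^ 2)) := by
  rw [show 2 * 1 = 2 by norm_num]
  have hsum : Summable fun k : ℕ => 1 / (((k : ℝ) + 1) ^ 2 + μ ^ 2) := by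
    have h := (summable_nat_add_iff 1).2 (Real.summable_one_div_nat_pow.2 one_lt_two)
    refine Summable.of_nonneg_of_le (fun k => by positivity) (fun k => ?_) h
    push_cast
    gcongr
    linarith [sq_nonneg μ]
  obtain ⟨T, hT⟩ := hsum
  have hT' := hT.tsum_eq
  suffices h : T = (π * μ * (cosh (π * μ) / sinh (π * μ)) - 1) / (2 * μ ^ 2) by rwa [← h]
  have hz : (μ * Complex.I : ℂ) ∈ Complex.integerComplement := by
    rintro ⟨n, hn⟩
    have := congrArg Complex.im hn
    simp at this
    exact hμ0.ne this
  have h := cot_series_rep' hz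
  have hμc : (μ : ℂ) ≠ 0 := by exact_mod_cast hμ0.ne'
  have hterm : ∀ n : ℕ, 1 / (μ * Complex.I - ((n : ℂ) + 1)) + 1 / (μ * Complex.I + ((n : ℂ) + 1))
      = (-2 * μ * Complex.I) * ((1 / (((n : ℝ) + 1) ^ 2 + μ ^ 2) : ℝ) : ℂ) := by
    intro n
    have h1 : (μ * Complex.I - ((n : ℂ) + 1)) * (μ * Complex.I + ((n : ℂ) + 1))
        = -(((((n : ℝ) + 1) ^ 2 + μ ^ 2 : ℝ)) : ℂ) := by
      push_cast
      linear_combination (μ : ℂ) ^ 2 * Complex.I_sq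
    have h0 : ((((n : ℝ) + 1) ^ 2 + μ ^ 2 : ℝ) : ℂ) ≠ 0 := by
      have : (0 : ℝ) < ((n : ℝ) + 1) ^ 2 + μ ^ 2 := by positivity
      exact_mod_cast this.ne'
    have h2 : (μ * Complex.I - ((n : ℂ) + 1)) ≠ 0 := by
      intro h; rw [h, zero_mul] at h1; exact h0 (neg_eq_zero.1 h1.symm)
    have h3 : (μ * Complex.I + ((n : ℂ) + 1)) ≠ 0 := by
      intro h; rw [h, mul_zero] at h1; exact h0 (neg_eq_zero.1 h1.symm)
    rw [div_add_div _ _ h2 h3, h1, Complex.ofReal_div, Complex.ofReal_one, mul_one_div, div_neg,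
      ← neg_div]
    congr 1
    ring
  simp_rw [hterm] at h
  rw [tsum_mul_left, ← Complex.ofReal_tsum, hT'] at h
  have hsh : sinh (π * μ) ≠ 0 := (sinh_pos_iff.2 (by positivity)).ne'
  have hshc : Complex.sinh (π * μ) ≠ 0 := by
    rw [← Complex.ofReal_mul, ← Complex.ofReal_sinh]; exact_mod_cast hsh
  have e1 : Complex.cot (π * (μ * Complex.I))
      = -Complex.I * (Complex.cosh (π * μ) / Complex.sinh (π * μ)) := by
    rw [Complex.cot, ← mul_assoc, Complex.cos_mul_I, Complex.sin_mul_I]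
    field_simp
    rw [Complex.I_sq]
    ring
  rw [e1] at h
  have e2 : (T : ℂ) = (((π * μ * (cosh (π * μ) / sinh (π * μ)) - 1) / (2 * μ ^ 2) : ℝ) : ℂ) := by
    push_cast
    have e3 : (1 : ℂ) / (μ * Complex.I) = -Complex.I / μ := by
      field_simp; rw [Complex.I_sq, neg_neg]
    rw [e3] at h
    have h4 : (2 * μ : ℂ) * T
        = π * (Complex.cosh (π * μ) / Complex.sinh (π * μ)) - 1 / μ := by
      have := congrArg (fun w => Complex.I * w) h
      have h5 : Complex.I * (-2 * μ * Complex.I * T) = 2 * μ * T := by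
        linear_combination (-2 * μ * T : ℂ) * Complex.I_sq
      rw [← h5, ← this]
      linear_combination -(π * (Complex.cosh (π * μ) / Complex.sinh (π * μ)) - 1 / (μ : ℂ))
        * Complex.I_sq
    have h6 : (T : ℂ) = (2 * μ * T) / (2 * μ) := by field_simp
    rw [h6, h4]
    generalize Complex.cosh (π * μ) / Complex.sinh (π * μ) = w
    field_simp
  exact_mod_cast e2

/-! ### The constant `c(l)` -/

theorem c_eq {l : ℕ} (hl : 1 ≤ l) :
    c l = ((2 * (l : ℝ) - 1) ^ (1 - 1 / (2 * (l : ℝ))) * sin (π * (1 / (2 * (l : ℝ)))))⁻¹ := by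
  have hl' : (1 : ℝ) ≤ l := by exact_mod_cast hl
  set α : ℝ := 1 / (2 * (l : ℝ)) with hα
  have hα0 : 0 < α := by positivity
  have h1 : 1 - α = (2 * l - 1) * α := by rw [hα]; field_simp
  rw [c, ← hα]
  congr 2
  have h2 : (1 - α) ^ (1 - α) = (2 * (l : ℝ) - 1) ^ (1 - α) * α ^ (1 - α) := by
    conv_lhs => rw [show (1 - α) ^ (1 - α) = ((2 * l - 1) * α) ^ (1 - α) by rw [← h1]]
    rw [mul_rpow (by linarith) hα0.le]
  have h3 : α ^ α * α ^ (1 - α) = α := by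
    rw [← rpow_add hα0]; simp
  calc 2 * (l : ℝ) * α ^ α * (1 - α) ^ (1 - α)
      = 2 * l * (α ^ α * α ^ (1 - α)) * (2 * (l : ℝ) - 1) ^ (1 - α) := by rw [h2]; ring
    _ = (2 * l * α) * (2 * (l : ℝ) - 1) ^ (1 - α) := by rw [h3]
    _ = _ := by rw [show 2 * (l : ℝ) * α = 1 by rw [hα]; field_simp, one_mul]

theorem c_pos {l : ℕ} (hl : 1 ≤ l) : 0 < c l := by
  have hl' : (1 : ℝ) ≤ l := by exact_mod_cast hl
  rw [c_eq hl]
  have := sin_pi_div_pos hl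
  have : 0 < 2 * (l : ℝ) - 1 := by linarith
  positivity

theorem c_one : c 1 = 1 := by
  rw [c_eq le_rfl]
  norm_num
  rw [show π * (1 / 2) = π / 2 by ring, sin_pi_div_two]

/-- The left side is the coefficient produced by the optimal `λ` in the pointwise bound. -/
theorem c_eq_halfLineIntegral {l : ℕ} (hl : 1 ≤ l) :
    2 * (l : ℝ) / ((2 * l - 1) * π) * ((2 * (l : ℝ) - 1) ^ (1 / (2 * (l : ℝ)))
      * halfLineIntegral l) = c l := by
  have hl' : (1 : ℝ) ≤ l := by exact_mod_cast hl
  have hq : 0 < 2 * (l : ℝ) - 1 := by linarith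
  have hs := sin_pi_div_pos hl
  rw [c_eq hl, halfLineIntegral, rpow_sub hq, rpow_one]
  set s := sin (π * (1 / (2 * (l : ℝ))))
  set w := (2 * (l : ℝ) - 1) ^ (1 / (2 * (l : ℝ)))
  have hw : 0 < w := rpow_pos_of_pos hq _
  field_simp

/-! ### Admissible constants -/

theorem ae_eq_zero_of_norm_eq_zero {f : L2} (h : ‖f‖ = 0) : ∀ᵐ x ∂period, f x = 0 := by
  rw [norm_eq_zero] at h
  rw [h]
  exact Lp.coeFn_zero ℝ 2 period

theorem admissible_of_pos_norm {l : ℕ} (hl : 1 ≤ l) {κ : ℝ}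
    (h : ∀ f ∈ SobolevZero l, 0 < ‖f‖ → ∀ᵐ x ∂period,
      f x ^ 2 ≤ c l * ‖f‖ ^ (2 - 1 / (l : ℝ)) * ‖weakDeriv l f‖ ^ (1 / (l : ℝ)) - κ * ‖f‖ ^ 2) :
    κ ∈ admissible l := by
  intro f hf
  rcases (norm_nonneg f).eq_or_lt with h0 | h0
  · filter_upwards [ae_eq_zero_of_norm_eq_zero h0.symm] with x hx
    have hl' : (1 : ℝ) ≤ l := by exact_mod_cast hl
    have : 1 / (l : ℝ) ≤ 1 := by rw [div_le_one (by positivity)]; exact hl'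
    rw [hx, ← h0, zero_rpow (by linarith)]
    simp
  · exact h f hf h0

theorem gap_admissible {l : ℕ} (hl : 1 ≤ l) :
    2 * (l : ℝ) / ((2 * l - 1) * π) * gap l ∈ admissible l := by
  have hl' : (1 : ℝ) ≤ l := by exact_mod_cast hl
  have hq1 : 1 ≤ 2 * (l : ℝ) - 1 := by linarith
  have hq : 0 < 2 * (l : ℝ) - 1 := by linarith
  refine admissible_of_pos_norm hl fun f hf ha => ?_
  have hab := SobolevZero.norm_le_norm_weakDeriv hf
  set a := ‖f‖
  set b := ‖weakDeriv l f‖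
  have hb : 0 < b := ha.trans_le hab
  set D := (b / a) ^ 2 with hD
  have hD1 : 1 ≤ D := one_le_pow₀ ((one_le_div ha).2 hab)
  have hD0 : 0 < D := by linarith
  set α : ℝ := 1 / (2 * (l : ℝ)) with hα
  -- With `T` replaced by its leading term, the bound is proportional to `λ^{α-1}(D + λ)`, which is
  -- minimal at `λ = (2l - 1)D`.
  set μ := ((2 * (l : ℝ) - 1) * D) ^ α with hμ
  have hprod : 1 ≤ (2 * (l : ℝ) - 1) * D := one_le_mul_of_one_le_of_one_le hq1 hD1
  have hμ1 : 1 ≤ μ := one_le_rpow hprod (by positivity)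
  have hμl : μ ^ (2 * l) = (2 * (l : ℝ) - 1) * D := by
    rw [hμ, ← rpow_natCast, ← rpow_mul (by positivity), hα]
    push_cast
    rw [one_div_mul_cancel (by positivity), rpow_one]
  obtain ⟨T, hT, hTle⟩ := exists_hasSum_le hl hμ1
  filter_upwards [SobolevZero.ae_sq_le hf (by positivity) hT] with x hx
  refine hx.trans ?_
  change T / π * (b ^ 2 + μ ^ (2 * l) * a ^ 2) ≤ _
  have hb2 : b ^ 2 = D * a ^ 2 := by rw [hD]; field_simp
  rw [hμl] at hTle ⊢
  have e1 : T / π * (b ^ 2 + (2 * (l : ℝ) - 1) * D * a ^ 2)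
      = a ^ 2 * (2 * l / ((2 * l - 1) * π)) * ((2 * (l : ℝ) - 1) * D * T) := by
    rw [hb2]; field_simp; ring
  have e2 : μ = (2 * (l : ℝ) - 1) ^ α * D ^ α := mul_rpow hq.le hD0.le
  have e3 : a ^ (2 - 1 / (l : ℝ)) * b ^ (1 / (l : ℝ)) = a ^ 2 * D ^ α := by
    rw [hD, ← rpow_natCast (b / a) 2, ← rpow_mul (by positivity), hα,
      show ((2 : ℕ) : ℝ) * (1 / (2 * l)) = 1 / l by push_cast; field_simp, div_rpow hb.le ha.le,
      rpow_sub ha, rpow_ofNat]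
    ring
  rw [e1, mul_assoc (c l), e3]
  calc a ^ 2 * (2 * l / ((2 * l - 1) * π)) * ((2 * (l : ℝ) - 1) * D * T)
      ≤ a ^ 2 * (2 * l / ((2 * l - 1) * π)) * (μ * halfLineIntegral l - gap l) := by gcongr
    _ = _ := by rw [← c_eq_halfLineIntegral hl, e2]; ring

/-- Put `B = d - 1`. With the cotangent replaced by `1` the left side is `2B - (B + 1)/B²`. The
shift by one thus gains `(B + 1)/B²`, which absorbs the exponentially small excess of `coth B`; a
cubic Taylor bound for `exp (2B)` and `B ≥ 2` suffice. -/
theorem coth_bound {d : ℝ} (hd : π ≤ d) :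
    ((d - 1) * (cosh (d - 1) / sinh (d - 1)) - 1) * (d ^ 2 / (d - 1) ^ 2 + 1) ≤ 2 * d - 2 := by
  have hpi := pi_gt_three
  obtain ⟨B, rfl⟩ : ∃ B, d = B + 1 := ⟨d - 1, by ring⟩
  rw [add_sub_cancel_right]
  have hB : 2 ≤ B := by linarith
  have hB0 : 0 < B := by linarith
  have hE : 1 + 2 * B + 2 * B ^ 2 + 4 / 3 * B ^ 3 ≤ exp (2 * B) := by
    have := sum_le_exp_of_nonneg (show 0 ≤ 2 * B by linarith) 4
    simp [Finset.sum_range_succ, Nat.factorial] at this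
    nlinarith
  have hE1 : 0 < exp (2 * B) - 1 := by
    have : 0 < 2 * B + 2 * B ^ 2 + 4 / 3 * B ^ 3 := by positivity
    linarith
  have hcoth : cosh B / sinh B = 1 + 2 / (exp (2 * B) - 1) := by
    have hs : 0 < sinh B := sinh_pos_iff.2 hB0
    rw [cosh_eq, sinh_eq, two_mul, exp_add]
    have h1 : exp (-B) = 1 / exp B := by rw [exp_neg, one_div]
    rw [two_mul, exp_add] at hE1
    rw [sinh_eq, h1] at hs
    have hp := exp_pos B
    rw [h1]
    have h2 : exp B - 1 / exp B ≠ 0 := by intro h; rw [h] at hs; simp at hs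
    have h3 : exp B ^ 2 - 1 ≠ 0 := by rw [pow_two]; exact hE1.ne'
    rw [← pow_two]
    field_simp
    ring
  rw [hcoth]
  have h1 : (2 * B) * (2 * B ^ 2 + 2 * B + 1) ≤ (B + 1) * (exp (2 * B) - 1) := by
    calc (2 * B) * (2 * B ^ 2 + 2 * B + 1)
        ≤ (B + 1) * (2 * B + 2 * B ^ 2 + 4 / 3 * B ^ 3) := by nlinarith [pow_pos hB0 3]
      _ ≤ _ := by gcongr; linarith
  have h2 : 2 * B / (exp (2 * B) - 1) * (2 * B ^ 2 + 2 * B + 1) ≤ B + 1 := by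
    rw [div_mul_eq_mul_div, div_le_iff₀ hE1]; exact h1
  have h3 : (B * (1 + 2 / (exp (2 * B) - 1)) - 1) * ((B + 1) ^ 2 / B ^ 2 + 1)
      = 2 * B + (2 * B / (exp (2 * B) - 1) * (2 * B ^ 2 + 2 * B + 1) - (B + 1)) / B ^ 2 := by
    have := hE1.ne'
    field_simp
    ring
  rw [h3]
  have : (2 * B / (exp (2 * B) - 1) * (2 * B ^ 2 + 2 * B + 1) - (B + 1)) / B ^ 2 ≤ 0 :=
    div_nonpos_of_nonpos_of_nonneg (by linarith) (by positivity)
  linarith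

theorem one_div_pi_admissible : 1 / π ∈ admissible 1 := by
  refine admissible_of_pos_norm le_rfl fun f hf ha => ?_
  have hab := SobolevZero.norm_le_norm_weakDeriv hf
  set a := ‖f‖
  set b := ‖weakDeriv 1 f‖
  have hpi := pi_gt_three
  set d := π * b / a with hd
  have hdpi : π ≤ d := by
    rw [hd, le_div_iff₀ ha]; gcongr
  -- The choice `πμ = d - 1`; the resulting bound `a²(d - 1)/π` is exactly `ab - a²/π`.
  have hμ : 0 < (d - 1) / π := div_pos (by linarith) pi_pos
  filter_upwards [SobolevZero.ae_sq_le hf (by positivity) (hasSum_one_div_sq_add_sq hμ)] with x hx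
  refine hx.trans ?_
  rw [mul_div_cancel₀ _ pi_ne_zero]
  have hc := coth_bound hdpi
  have hd1 : d - 1 ≠ 0 := by linarith
  have hbd : b = d * a / π := by rw [hd]; field_simp
  change _ * (b ^ 2 + ((d - 1) / π) ^ 2 * a ^ 2) ≤ _
  rw [c_one, Nat.cast_one, div_one, show (2 : ℝ) - 1 = 1 by norm_num, rpow_one, rpow_one, one_mul]
  calc _ = a ^ 2 / (2 * π) * (((d - 1) * (cosh (d - 1) / sinh (d - 1)) - 1)
        * (d ^ 2 / (d - 1) ^ 2 + 1)) := by
          rw [hbd]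
          generalize cosh (d - 1) / sinh (d - 1) = w
          field_simp
    _ ≤ a ^ 2 / (2 * π) * (2 * d - 2) := by gcongr
    _ = _ := by rw [hbd]; field_simp

/-! ### The sharp constant is attained -/

theorem continuous_trig (n : ℤ) (z : ℂ) : Continuous (trig n z) := (contDiff_trig n z).continuous

theorem memLp_trig (n : ℤ) (z : ℂ) : MemLp (trig n z) 2 period := by
  refine MemLp.of_bound (continuous_trig n z).aestronglyMeasurable ‖z‖ (ae_of_all _ fun x => ?_)
  rw [trig, Real.norm_eq_abs]
  refine (Complex.abs_re_le_norm _).trans ?_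
  have : (-(n * x * Complex.I) : ℂ) = ((-(n * x) : ℝ) : ℂ) * Complex.I := by push_cast; ring
  rw [norm_mul, this, Complex.norm_exp_ofReal_mul_I, mul_one]

theorem integral_by_parts {u v : ℝ → ℝ} (hu : ContDiff ℝ 1 u) (hv : ContDiff ℝ 1 v)
    (hup : Function.Periodic u (2 * π)) (hvp : Function.Periodic v (2 * π)) :
    ∫ x, u x * deriv v x ∂period = -∫ x, deriv u x * v x ∂period := by
  have h := intervalIntegral.integral_mul_deriv_eq_deriv_mul (a := 0) (b := 2 * π)
    (u := u) (v := v) (u' := deriv u) (v' := deriv v)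
    (fun x _ => (hu.differentiable (by norm_num) x).hasDerivAt)
    (fun x _ => (hv.differentiable (by norm_num) x).hasDerivAt)
    ((hu.continuous_deriv le_rfl).intervalIntegrable _ _)
    ((hv.continuous_deriv le_rfl).intervalIntegrable _ _)
  have h1 := hup 0
  have h2 := hvp 0
  rw [zero_add] at h1 h2
  rw [h1, h2, sub_self, zero_sub, intervalIntegral.integral_of_le two_pi_pos.le,
    intervalIntegral.integral_of_le two_pi_pos.le] at h
  exact h

theorem periodic_iteratedDeriv {ψ : ℝ → ℝ} {T : ℝ} (h : Function.Periodic ψ T) (k : ℕ) :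
    Function.Periodic (iteratedDeriv k ψ) T := by
  intro x
  have := congrFun (iteratedDeriv_comp_add_const k ψ T) x
  rw [← this]
  congr 1
  exact funext h

theorem integral_trig_mul_iteratedDeriv (n : ℤ) (k : ℕ) (z : ℂ) {ψ : ℝ → ℝ}
    (hψ : ContDiff ℝ (⊤ : ℕ∞) ψ) (hp : Function.Periodic ψ (2 * π)) :
    ∫ x, trig n z x * iteratedDeriv k ψ x ∂period
      = (-1) ^ k * ∫ x, trig n ((-(n * Complex.I)) ^ k * z) x * ψ x ∂period := by
  induction k generalizing z with
  | zero => simp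
  | succ k ih =>
    rw [iteratedDeriv_succ, integral_by_parts
      ((contDiff_trig n z).of_le (by exact_mod_cast le_top))
      (by rw [iteratedDeriv_eq_iterate]
          exact ContDiff.iterate_deriv' 1 k (hψ.of_le (by exact_mod_cast le_top)))
      (periodic_trig n z) (periodic_iteratedDeriv hp k), deriv_trig, ih, ← mul_assoc (_ ^ k),
      ← pow_succ, pow_succ (-1 : ℝ)]
    ring

theorem isWeakDeriv_trig (n : ℤ) (k : ℕ) (z : ℂ) :
    IsWeakDeriv k ((memLp_trig n z).toLp _)
      ((memLp_trig n ((-(n * Complex.I)) ^ k * z)).toLp _) := by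
  intro ψ hψ hp
  have e : ∀ (w : ℂ) (χ : ℝ → ℝ), ∫ x, ((memLp_trig n w).toLp _ : L2) x * χ x ∂period
      = ∫ x, trig n w x * χ x ∂period := by
    intro w χ
    refine integral_congr_ae ?_
    filter_upwards [(memLp_trig n w).coeFn_toLp] with x hx
    rw [hx]
  rw [e, e, integral_trig_mul_iteratedDeriv n k z hψ hp]

theorem exists_mem_sobolevZero_norm_pos (l : ℕ) : ∃ f ∈ SobolevZero l, 0 < ‖f‖ := by
  refine ⟨(memLp_trig 1 1).toLp _, ⟨?_, fun k _ => ⟨_, isWeakDeriv_trig 1 k 1⟩⟩, ?_⟩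
  · rw [integral_congr_ae (memLp_trig 1 1).coeFn_toLp]
    -- `trig 1 1` is the derivative of the periodic function `trig 1 I`, so its mean vanishes.
    have h := integral_by_parts (u := fun _ => 1) contDiff_const
      ((contDiff_trig 1 Complex.I).of_le (by exact_mod_cast le_top)) (fun _ => rfl)
      (periodic_trig 1 Complex.I)
    simpa [deriv_trig] using h
  · rw [norm_pos_iff]
    intro h0
    have h1 : trig 1 1 =ᵐ[period] 0 := by
      have h2 := (memLp_trig 1 1).coeFn_toLp
      rw [h0] at h2
      exact h2.symm.trans (Lp.coeFn_zero ℝ 2 period)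
    have h3 : ∫ x, cos x ^ 2 ∂period = 0 := by
      rw [← integral_zero ℝ ℝ (μ := period)]
      refine integral_congr_ae ?_
      filter_upwards [h1] with x hx
      have : trig 1 1 x = cos x := by
        rw [trig, one_mul, Int.cast_one, one_mul, ← neg_mul, ← Complex.ofReal_neg,
          Complex.exp_ofReal_mul_I_re, cos_neg]
      rw [← this, hx]
      simp
    rw [← intervalIntegral.integral_of_le two_pi_pos.le, integral_cos_sq] at h3
    simp at h3

theorem period_ne_zero : period ≠ 0 := by
  intro h
  have := congrArg (fun m : Measure ℝ => m Set.univ) h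
  simp [pi_pos.not_ge] at this

theorem bddAbove_admissible (l : ℕ) : BddAbove (admissible l) := by
  obtain ⟨f, hf, h0⟩ := exists_mem_sobolevZero_norm_pos l
  refine ⟨c l * ‖f‖ ^ (2 - 1 / (l : ℝ)) * ‖weakDeriv l f‖ ^ (1 / (l : ℝ)) / ‖f‖ ^ 2, ?_⟩
  intro κ hκ
  have : (ae period).NeBot := ae_neBot.2 period_ne_zero
  obtain ⟨x, hx⟩ := (hκ f hf).exists
  rw [le_div_iff₀ (by positivity)]
  have := sq_nonneg (f x)
  linarith

/-- The supremum is approached by a sequence of admissible constants, and a countable union of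
exceptional null sets is null. -/
theorem isGreatest_K {l : ℕ} (hl : 1 ≤ l) : IsGreatest (admissible l) (K l) := by
  have hne : (admissible l).Nonempty := ⟨_, gap_admissible hl⟩
  refine ⟨?_, fun κ hκ => le_csSup (bddAbove_admissible l) hκ⟩
  obtain ⟨u, -, hu, hmem⟩ := exists_seq_tendsto_sSup hne (bddAbove_admissible l)
  intro f hf
  filter_upwards [ae_all_iff.2 fun n => hmem n f hf] with x hx
  exact ge_of_tendsto' (tendsto_const_nhds.sub (hu.mul_const _)) hx

theorem K_pos {l : ℕ} (hl : 1 ≤ l) : 0 < K l := by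
  have hl' : (1 : ℝ) ≤ l := by exact_mod_cast hl
  have : 0 < 2 * (l : ℝ) - 1 := by linarith
  have := gap_pos l
  exact lt_of_lt_of_le (by positivity) ((isGreatest_K hl).2 (gap_admissible hl))

theorem one_div_pi_le_K_one : 1 / π ≤ K 1 := (isGreatest_K le_rfl).2 one_div_pi_admissible

theorem ae_bounded {l : ℕ} (hl : 1 ≤ l) {f : L2} (hf : f ∈ SobolevZero l) :
    ∃ C, ∀ᵐ x ∂period, ‖f x‖ ≤ C := by
  obtain ⟨M, hM⟩ : ∃ M, ∀ᵐ x ∂period, f x ^ 2 ≤ M := ⟨_, (isGreatest_K hl).1 f hf⟩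
  refine ⟨√M, ?_⟩
  filter_upwards [hM] with x hx
  exact abs_le_sqrt hx

/-! ### Two elementary inequalities -/

/-- For `n > 0`, divide by `n²`, raise to the power `2l`, and use `x^{2l} + κ^{2l} ≤ (x + κ)^{2l}`.
It is applied with `n² = ρ(x)` and `r² = Q(x)`. -/
theorem sobolev_pow_bound {l : ℕ} (hl : 1 ≤ l) {n r C κ : ℝ} (hn : 0 ≤ n) (hr : 0 ≤ r)
    (hC : 0 ≤ C) (hκ : 0 ≤ κ)
    (h : (n ^ 2) ^ 2 ≤ C * n ^ (2 - 1 / (l : ℝ)) * r ^ (1 / (l : ℝ)) - κ * n ^ 2) :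
    (n ^ 2) ^ (2 * l + 1) + κ ^ (2 * l) * n ^ 2 ≤ C ^ (2 * l) * r ^ 2 := by
  rcases hn.eq_or_lt with rfl | hn
  · simp; positivity
  have h1 : n ^ 2 + κ ≤ C * (r / n) ^ (1 / (l : ℝ)) := by
    rw [div_rpow hr hn.le]
    rw [rpow_sub hn, rpow_ofNat] at h
    have hw : 0 < n ^ (1 / (l : ℝ)) := rpow_pos_of_pos hn _
    refine le_of_mul_le_mul_left ?_ (show 0 < n ^ 2 by positivity)
    calc n ^ 2 * (n ^ 2 + κ) = (n ^ 2) ^ 2 + κ * n ^ 2 := by ring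
      _ ≤ C * (n ^ 2 / n ^ (1 / (l : ℝ))) * r ^ (1 / (l : ℝ)) := by linarith
      _ = _ := by ring
  have h2 : (n ^ 2) ^ (2 * l) + κ ^ (2 * l) ≤ (n ^ 2 + κ) ^ (2 * l) :=
    pow_add_pow_le (by positivity) hκ (by omega)
  have h3 : (n ^ 2 + κ) ^ (2 * l) ≤ C ^ (2 * l) * (r / n) ^ 2 := by
    refine (pow_le_pow_left₀ (by positivity) h1 _).trans (le_of_eq ?_)
    have hl0 : (l : ℝ) ≠ 0 := by exact_mod_cast (by omega : l ≠ 0)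
    rw [mul_pow, mul_comm 2 l, pow_mul ((r / n) ^ (1 / (l : ℝ))), ← rpow_natCast _ l,
      ← rpow_mul (by positivity), one_div_mul_cancel hl0, rpow_one]
  calc (n ^ 2) ^ (2 * l + 1) + κ ^ (2 * l) * n ^ 2
      = n ^ 2 * ((n ^ 2) ^ (2 * l) + κ ^ (2 * l)) := by ring
    _ ≤ n ^ 2 * (C ^ (2 * l) * (r / n) ^ 2) := by
        gcongr; exact h2.trans h3
    _ = _ := by field_simp

theorem young_bound {l : ℕ} (hl : 1 ≤ l) {C v ρ : ℝ} (hC : 0 < C) (hv : 0 ≤ v) (hρ : 0 ≤ ρ) :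
    v * ρ ≤ ρ ^ (2 * l + 1) / C ^ (2 * l)
      + 2 * (l : ℝ) / (2 * (l : ℝ) + 1) ^ ((2 * (l : ℝ) + 1) / (2 * (l : ℝ))) * C
        * v ^ ((2 * (l : ℝ) + 1) / (2 * (l : ℝ))) := by
  have hl' : (1 : ℝ) ≤ l := by exact_mod_cast hl
  set p : ℝ := 2 * (l : ℝ) + 1 with hp
  set q : ℝ := p / (2 * (l : ℝ)) with hq
  have hp0 : 0 < p := by positivity
  have hq0 : 0 < q := by positivity
  have hpq : p.HolderConjugate q := by
    rw [holderConjugate_iff]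
    refine ⟨by rw [hp]; linarith, ?_⟩
    rw [hq]; field_simp; rw [hp, add_comm]
  -- The scaling for which Young's inequality for `(ρs)(v/s)` has `1 / C ^ (2l)` in front of `ρ ^
  -- (2l+1)`.
  set s : ℝ := p ^ (1 / p) / C ^ (2 * l / p) with hs
  have hs0 : 0 < s := by positivity
  have hsp : s ^ p = p / C ^ (2 * l) := by
    rw [hs, div_rpow (by positivity) (by positivity), ← rpow_mul hp0.le, ← rpow_mul hC.le,
      one_div_mul_cancel hp0.ne', div_mul_cancel₀ _ hp0.ne', rpow_one, ← rpow_natCast C]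
    push_cast
    rfl
  have hpq1 : q / p = 1 / (2 * (l : ℝ)) := by rw [hq]; field_simp
  have hsq : s ^ q = p ^ (q - 1) / C := by
    rw [hs, div_rpow (by positivity) (by positivity), ← rpow_mul hp0.le, ← rpow_mul hC.le]
    have e1 : 1 / p * q = q - 1 := by rw [hq]; field_simp; rw [hp]; ring
    have e2 : 2 * (l : ℝ) / p * q = 1 := by rw [hq]; field_simp
    rw [e1, e2, rpow_one]
  have hy := young_inequality_of_nonneg (mul_nonneg hρ hs0.le) (div_nonneg hv hs0.le) hpq
  have e0 : ρ * s * (v / s) = v * ρ := by field_simp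
  rw [e0, mul_rpow hρ hs0.le, div_rpow hv hs0.le, hsp, hsq] at hy
  refine hy.trans (le_of_eq ?_)
  have e3 : ρ ^ p = ρ ^ (2 * l + 1) := by
    rw [← rpow_natCast ρ, hp]; push_cast; rfl
  rw [e3, rpow_sub hp0, rpow_one]
  have hw : 0 < p ^ q := by positivity
  congr 1
  · field_simp
  · generalize p ^ q = w at *
    rw [hq]
    generalize v ^ (p / (2 * (l : ℝ))) = y
    field_simp

/-! ### Orthonormal families -/

section Orthonormal

variable {ι : Type*} [Fintype ι]

/-- One null set must serve all `ξ`, since `ξ` will depend on `x`. Rational `ξ` are countable and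
dense, and both sides are continuous in `ξ`. -/
theorem ae_sum_smul_le {l : ℕ} (hl : 1 ≤ l) (ψ : ι → L2) (hψ : ∀ j, ψ j ∈ SobolevZero l) :
    ∀ᵐ x ∂period, ∀ ξ : ι → ℝ, (∑ j, ξ j * ψ j x) ^ 2
      ≤ c l * ‖∑ j, ξ j • ψ j‖ ^ (2 - 1 / (l : ℝ))
          * ‖∑ j, ξ j • weakDeriv l (ψ j)‖ ^ (1 / (l : ℝ)) - K l * ‖∑ j, ξ j • ψ j‖ ^ 2 := by
  have hl' : (1 : ℝ) ≤ l := by exact_mod_cast hl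
  have h1 : ∀ ξ : ι → ℝ, ∀ᵐ x ∂period, (∑ j, ξ j * ψ j x) ^ 2
      ≤ c l * ‖∑ j, ξ j • ψ j‖ ^ (2 - 1 / (l : ℝ))
          * ‖∑ j, ξ j • weakDeriv l (ψ j)‖ ^ (1 / (l : ℝ)) - K l * ‖∑ j, ξ j • ψ j‖ ^ 2 := by
    intro ξ
    set F : sobolevSubmodule l := ∑ j, ξ j • ⟨ψ j, hψ j⟩ with hF
    have hFc : (F : L2) = ∑ j, ξ j • ψ j := by simp [hF]
    have hFd : weakDeriv l F = ∑ j, ξ j • weakDeriv l (ψ j) := by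
      rw [← derivLinear_apply, hF, map_sum]
      simp [derivLinear_apply]
    have h := (isGreatest_K hl).1 F F.2
    rw [hFd, hFc] at h
    have h2 : ∀ j, ∀ᵐ x ∂period, (ξ j • ψ j : L2) x = ξ j * ψ j x := fun j => by
      filter_upwards [Lp.coeFn_smul (ξ j) (ψ j)] with x hx
      rw [hx]; rfl
    filter_upwards [h, ae_all_iff.2 h2, Lp.coeFn_finsetSum Finset.univ fun j => ξ j • ψ j]
      with x hx hx2 hx3
    rw [hx3] at hx
    simpa [hx2] using hx
  have h2 := ae_all_iff.2 fun ξ : ι → ℚ => h1 fun j => (ξ j : ℝ)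
  filter_upwards [h2] with x hx ξ
  have hd : DenseRange fun (ξ : ι → ℚ) (j : ι) => (ξ j : ℝ) :=
    DenseRange.piMap fun _ => Rat.denseRange_cast
  refine hd.induction_on (p := fun ξ : ι → ℝ => (∑ j, ξ j * ψ j x) ^ 2
      ≤ c l * ‖∑ j, ξ j • ψ j‖ ^ (2 - 1 / (l : ℝ))
          * ‖∑ j, ξ j • weakDeriv l (ψ j)‖ ^ (1 / (l : ℝ)) - K l * ‖∑ j, ξ j • ψ j‖ ^ 2)
    ξ ?_ hx
  have hle : 1 / (l : ℝ) ≤ 1 := by rw [div_le_one (by positivity)]; exact hl'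
  have c1 : Continuous fun ξ : ι → ℝ => ‖∑ j, ξ j • ψ j‖ := by fun_prop
  have c2 : Continuous fun ξ : ι → ℝ => ‖∑ j, ξ j • weakDeriv l (ψ j)‖ := by fun_prop
  have c3 := c1.rpow_const (p := 2 - 1 / (l : ℝ)) fun _ => Or.inr (by linarith)
  have c4 := c2.rpow_const (p := 1 / (l : ℝ)) fun _ => Or.inr (by positivity)
  exact isClosed_le (by fun_prop) (by fun_prop)

theorem norm_sq_sum_smul {ψ : ι → L2} (ho : Orthonormal ℝ ψ) (ξ : ι → ℝ) :
    ‖∑ j, ξ j • ψ j‖ ^ 2 = ∑ j, ξ j ^ 2 := by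
  rw [← real_inner_self_eq_norm_sq, ho.inner_sum]
  simp [pow_two]

/-- The density `∑ ψ j ^ 2` of a finite family. -/
def density (ψ : ι → L2) (x : ℝ) : ℝ := ∑ j, ψ j x ^ 2

theorem density_nonneg (ψ : ι → L2) (x : ℝ) : 0 ≤ density ψ x :=
  Finset.sum_nonneg fun _ _ => sq_nonneg _

theorem aestronglyMeasurable_density (ψ : ι → L2) : AEStronglyMeasurable (density ψ) period := by
  unfold density
  exact Finset.aestronglyMeasurable_fun_sum _ fun j _ => (Lp.aestronglyMeasurable (ψ j)).pow 2

theorem ae_bounded_density {l : ℕ} (hl : 1 ≤ l) {ψ : ι → L2} (hψ : ∀ j, ψ j ∈ SobolevZero l) :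
    ∃ C, ∀ᵐ x ∂period, ‖density ψ x‖ ≤ C := by
  choose C hC using fun j => ae_bounded hl (hψ j)
  refine ⟨∑ j, C j ^ 2, ?_⟩
  filter_upwards [ae_all_iff.2 hC] with x hx
  rw [Real.norm_of_nonneg (density_nonneg ψ x)]
  refine Finset.sum_le_sum fun j _ => ?_
  rw [← sq_abs]
  exact pow_le_pow_left₀ (abs_nonneg _) (hx j) 2

theorem integrable_mul_Lp (f g : L2) : Integrable (fun x => f x * g x) period :=
  (Lp.memLp f).integrable_mul (Lp.memLp g)

theorem integral_density (ψ : ι → L2) (ho : Orthonormal ℝ ψ) :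
    ∫ x, density ψ x ∂period = Fintype.card ι := by
  unfold density
  rw [integral_finsetSum _ fun j _ => by simpa [pow_two] using integrable_mul_Lp (ψ j) (ψ j)]
  simp [← norm_sq_eq_integral, ho.norm_eq_one]

/-- The collective Sobolev inequality for orthonormal families. -/
theorem integral_density_pow_le {l : ℕ} (hl : 1 ≤ l) {ψ : ι → L2} (hψ : ∀ j, ψ j ∈ SobolevZero l)
    (ho : Orthonormal ℝ ψ) :
    (∫ x, density ψ x ^ (2 * l + 1) ∂period) + K l ^ (2 * l) * Fintype.card ι
      ≤ c l ^ (2 * l) * ∑ j, ‖weakDeriv l (ψ j)‖ ^ 2 := by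
  set Q : ℝ → ℝ := fun x => ‖∑ j, ψ j x • weakDeriv l (ψ j)‖ ^ 2 with hQ
  have hQeq : ∀ x, Q x = ∑ i, ∑ j, inner ℝ (weakDeriv l (ψ i)) (weakDeriv l (ψ j))
      * (ψ i x * ψ j x) := by
    intro x
    rw [hQ]
    dsimp only
    rw [← real_inner_self_eq_norm_sq, sum_inner]
    refine Finset.sum_congr rfl fun i _ => ?_
    rw [inner_sum]
    refine Finset.sum_congr rfl fun j _ => ?_
    rw [real_inner_smul_left, real_inner_smul_right]
    ring
  have hint : ∀ i j, Integrable (fun x => inner ℝ (weakDeriv l (ψ i)) (weakDeriv l (ψ j))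
      * (ψ i x * ψ j x)) period := fun i j => (integrable_mul_Lp _ _).const_mul _
  have hQint : Integrable Q period := by
    rw [funext hQeq]
    exact integrable_finsetSum _ fun i _ => integrable_finsetSum _ fun j _ => hint i j
  -- The derivatives need not be orthogonal: the cross terms disappear because their coefficients
  -- `ψ_i ψ_j` integrate to zero.
  have hQval : ∫ x, Q x ∂period = ∑ j, ‖weakDeriv l (ψ j)‖ ^ 2 := by
    rw [funext hQeq, integral_finsetSum _ fun i _ => integrable_finsetSum _ fun j _ => hint i j]
    refine Finset.sum_congr rfl fun i _ => ?_
    rw [integral_finsetSum _ fun j _ => hint i j]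
    simp_rw [integral_const_mul, ← inner_eq_integral]
    classical
    rw [Finset.sum_eq_single i]
    · rw [real_inner_self_eq_norm_sq, real_inner_self_eq_norm_sq, ho.norm_eq_one]; ring
    · intro j _ hj
      rw [ho.inner_eq_zero hj.symm, mul_zero]
    · simp
  have hpt : ∀ᵐ x ∂period, density ψ x ^ (2 * l + 1) + K l ^ (2 * l) * density ψ x
      ≤ c l ^ (2 * l) * Q x := by
    filter_upwards [ae_sum_smul_le hl ψ hψ] with x hx
    -- With `ξ_j = ψ_j(x)`, both the linear combination at `x` and its squared norm equal `ρ(x)`.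
    have h := hx fun j => ψ j x
    have hn := norm_sq_sum_smul ho fun j => ψ j x
    have hd : density ψ x = ‖∑ j, ψ j x • ψ j‖ ^ 2 := hn.symm
    have hd' : ∑ j, ψ j x * ψ j x = ‖∑ j, ψ j x • ψ j‖ ^ 2 := by
      rw [hn]; simp [pow_two]
    rw [hd'] at h
    rw [hd]
    exact sobolev_pow_bound hl (norm_nonneg _) (norm_nonneg _) (c_pos hl).le (K_pos hl).le h
  obtain ⟨C, hC⟩ := ae_bounded_density hl hψ
  have hm := aestronglyMeasurable_density ψ
  have hi1 : Integrable (fun x => density ψ x ^ (2 * l + 1)) period := by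
    refine Integrable.of_bound (hm.pow _) (C ^ (2 * l + 1)) ?_
    filter_upwards [hC] with x hx
    rw [norm_pow]
    exact pow_le_pow_left₀ (norm_nonneg _) hx _
  have hi2 : Integrable (density ψ) period := Integrable.of_bound hm C hC
  have := integral_mono_ae (hi1.add (hi2.const_mul _)) (hQint.const_mul _) hpt
  simp only [Pi.add_apply] at this
  rwa [integral_add hi1 (hi2.const_mul _), integral_const_mul, integral_const_mul,
    integral_density ψ ho, hQval] at this

end Orthonormal

/-! ### The potential and the trace of the operator -/

section Potential

variable {l : ℕ} {V : ℝ → ℝ}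

theorem one_lt_exponent (hl : 1 ≤ l) : 1 < (2 * (l : ℝ) + 1) / (2 * (l : ℝ)) := by
  have hl' : (1 : ℝ) ≤ l := by exact_mod_cast hl
  rw [one_lt_div (by positivity)]
  linarith

theorem integrable_potential (hl : 1 ≤ l)
    (hV : MemLp V (ENNReal.ofReal ((2 * (l : ℝ) + 1) / (2 * (l : ℝ)))) period) :
    Integrable V period :=
  hV.integrable (ENNReal.one_le_ofReal.2 (one_lt_exponent hl).le)

theorem integrable_potential_mul (hl : 1 ≤ l) (hV : Integrable V period) {u v : L2}
    (hu : u ∈ SobolevZero l) (hv : v ∈ SobolevZero l) :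
    Integrable (fun x => V x * (u x * v x)) period := by
  obtain ⟨C, hC⟩ := ae_bounded hl hu
  obtain ⟨D, hD⟩ := ae_bounded hl hv
  refine hV.mul_bdd (c := C * D)
    ((Lp.aestronglyMeasurable u).mul (Lp.aestronglyMeasurable v)) ?_
  filter_upwards [hC, hD] with x h1 h2
  rw [norm_mul]
  exact mul_le_mul h1 h2 (norm_nonneg _) ((norm_nonneg _).trans h1)

/-- Young's inequality bounds `∫ Vρ` with coefficient `1 / c ^ (2l)` on `∫ ρ^{2l+1}`, precisely what
the collective inequality, divided by `c ^ (2l)`, controls. -/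
theorem sum_form_ge (hl : 1 ≤ l) (hV0 : ∀ᵐ x ∂period, 0 ≤ V x)
    (hV : MemLp V (ENNReal.ofReal ((2 * (l : ℝ) + 1) / (2 * (l : ℝ)))) period)
    {ι : Type*} [Fintype ι] {ψ : ι → L2} (hψ : ∀ j, ψ j ∈ SobolevZero l)
    (ho : Orthonormal ℝ ψ) :
    Fintype.card ι * (K l / c l) ^ (2 * l) ≤ ∑ j, form l V (ψ j) (ψ j)
      + 2 * (l : ℝ) / (2 * (l : ℝ) + 1) ^ ((2 * (l : ℝ) + 1) / (2 * (l : ℝ))) * c l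
        * ∫ x, V x ^ ((2 * (l : ℝ) + 1) / (2 * (l : ℝ))) ∂period := by
  have hVi := integrable_potential hl hV
  have hc := c_pos hl
  have hq := one_lt_exponent hl
  set q := (2 * (l : ℝ) + 1) / (2 * (l : ℝ)) with hqdef
  set Y := 2 * (l : ℝ) / (2 * (l : ℝ) + 1) ^ q * c l with hY
  have hVq : Integrable (fun x => V x ^ q) period := by
    have h := hV.integrable_norm_rpow (by simpa using by linarith) ENNReal.ofReal_ne_top
    rw [ENNReal.toReal_ofReal (by linarith)] at h
    refine h.congr ?_
    filter_upwards [hV0] with x hx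
    rw [Real.norm_of_nonneg hx]
  obtain ⟨C, hC⟩ := ae_bounded_density hl hψ
  have hm := aestronglyMeasurable_density ψ
  have hi1 : Integrable (fun x => density ψ x ^ (2 * l + 1) / c l ^ (2 * l)) period := by
    refine Integrable.div_const (Integrable.of_bound (hm.pow _) (C ^ (2 * l + 1)) ?_) _
    filter_upwards [hC] with x hx
    rw [Pi.pow_apply, norm_pow]
    exact pow_le_pow_left₀ (norm_nonneg _) hx _
  have h1 : ∫ x, V x * density ψ x ∂period
      ≤ (∫ x, density ψ x ^ (2 * l + 1) ∂period) / c l ^ (2 * l)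
        + Y * ∫ x, V x ^ q ∂period := by
    rw [← integral_div, ← integral_const_mul, ← integral_add hi1 (hVq.const_mul _)]
    refine integral_mono_ae (hVi.mul_bdd hm hC) (hi1.add (hVq.const_mul _)) ?_
    filter_upwards [hV0] with x hx
    exact young_bound hl hc hx (density_nonneg ψ x)
  have h2 : ∑ j, form l V (ψ j) (ψ j)
      = ∑ j, ‖weakDeriv l (ψ j)‖ ^ 2 - ∫ x, V x * density ψ x ∂period := by
    unfold form density
    rw [Finset.sum_sub_distrib]
    congr 1
    · refine Finset.sum_congr rfl fun j _ => ?_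
      rw [← inner_eq_integral, real_inner_self_eq_norm_sq]
    · rw [← integral_finsetSum _ fun j _ => integrable_potential_mul hl hVi (hψ j) (hψ j)]
      simp_rw [Finset.mul_sum, pow_two]
  have h3 := integral_density_pow_le hl hψ ho
  have h4 : (∫ x, density ψ x ^ (2 * l + 1) ∂period) / c l ^ (2 * l)
      + Fintype.card ι * (K l / c l) ^ (2 * l) ≤ ∑ j, ‖weakDeriv l (ψ j)‖ ^ 2 := by
    rw [div_pow, mul_div_assoc', ← add_div, div_le_iff₀ (by positivity)]
    linarith
  linarith

/-- The graph of the operator `A`, as a subspace. -/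
def imageGraph (hl : 1 ≤ l) (hV : Integrable V period) : Submodule ℝ (L2 × L2) where
  carrier := {p | IsImage l V p.1 p.2}
  add_mem' := by
    rintro ⟨u, w⟩ ⟨u', w'⟩ ⟨hu, hw, h⟩ ⟨hu', hw', h'⟩
    refine ⟨(sobolevSubmodule l).add_mem hu hu', ?_, fun v hv => ?_⟩
    · dsimp only [Prod.fst_add, Prod.snd_add] at *
      rw [integral_congr_ae (Lp.coeFn_add w w')]
      simp only [Pi.add_apply]
      rw [integral_add ((Lp.memLp w).integrable (by norm_num))
        ((Lp.memLp w').integrable (by norm_num)), hw, hw', add_zero]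
    · have h1 := h v hv
      have h2 := h' v hv
      have hd : weakDeriv l (u + u') = weakDeriv l u + weakDeriv l u' :=
        map_add (derivLinear l) ⟨u, hu⟩ ⟨u', hu'⟩
      have e : ∫ x, V x * ((u + u' : L2) x * v x) ∂period
          = (∫ x, V x * (u x * v x) ∂period) + ∫ x, V x * (u' x * v x) ∂period := by
        rw [← integral_add (integrable_potential_mul hl hV hu hv)
          (integrable_potential_mul hl hV hu' hv)]
        refine integral_congr_ae ?_
        filter_upwards [Lp.coeFn_add u u'] with x hx
        rw [hx, Pi.add_apply]
        ring
      simp only [form, ← inner_eq_integral] at h1 h2 ⊢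
      dsimp only [Prod.fst_add, Prod.snd_add] at *
      rw [hd, inner_add_left, inner_add_left, e]
      linarith
  zero_mem' := by
    have hd : weakDeriv l (0 : L2) = 0 := map_zero (derivLinear l)
    refine ⟨(sobolevSubmodule l).zero_mem, ?_, fun v hv => ?_⟩
    · exact (sobolevSubmodule l).zero_mem.1
    · have e : ∫ x, V x * ((0 : L2) x * v x) ∂period = 0 := by
        rw [← integral_zero ℝ ℝ (μ := period)]
        refine integral_congr_ae ?_
        filter_upwards [Lp.coeFn_zero ℝ 2 period] with x hx
        rw [hx]
        simp
      simp only [form, ← inner_eq_integral]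
      dsimp only [Prod.fst_zero, Prod.snd_zero] at *
      rw [hd, e, inner_zero_left, inner_zero_left, sub_zero]
  smul_mem' := by
    rintro a ⟨u, w⟩ ⟨hu, hw, h⟩
    refine ⟨(sobolevSubmodule l).smul_mem a hu, ?_, fun v hv => ?_⟩
    · dsimp only [Prod.smul_fst, Prod.smul_snd] at *
      rw [integral_congr_ae (Lp.coeFn_smul a w)]
      simp only [Pi.smul_apply]
      rw [integral_smul, hw, smul_zero]
    · have h1 := h v hv
      have hd : weakDeriv l (a • u) = a • weakDeriv l u :=
        map_smul (derivLinear l) a ⟨u, hu⟩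
      have e : ∫ x, V x * ((a • u : L2) x * v x) ∂period
          = a * ∫ x, V x * (u x * v x) ∂period := by
        rw [← integral_const_mul]
        refine integral_congr_ae ?_
        filter_upwards [Lp.coeFn_smul a u] with x hx
        rw [hx, Pi.smul_apply, smul_eq_mul]
        ring
      simp only [form, ← inner_eq_integral] at h1 ⊢
      dsimp only [Prod.smul_fst, Prod.smul_snd] at *
      rw [hd, real_inner_smul_left, real_inner_smul_left, e, ← h1]
      ring

/-- The trace of `A` on a span of eigenfunctions can be computed in an orthonormal basis. -/
theorem exists_orthonormal_sum_form (hl : 1 ≤ l) (hV : Integrable V period) {N : ℕ}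
    {ν : Fin N → ℝ} {φ : Fin N → L2} (hφ : LinearIndependent ℝ φ)
    (he : ∀ j, IsEigenfunction l V (-ν j) (φ j)) :
    ∃ ψ : Fin N → L2, Orthonormal ℝ ψ ∧ (∀ j, ψ j ∈ SobolevZero l) ∧
      ∑ j, form l V (ψ j) (ψ j) = -∑ j, ν j := by
  set W := Submodule.span ℝ (Set.range φ) with hW
  let b : Module.Basis (Fin N) ℝ W := Module.Basis.span hφ
  have hb : ∀ j, (b j : L2) = φ j := fun j =>
    congrArg Subtype.val (Module.Basis.span_apply hφ j)
  have : FiniteDimensional ℝ W := b.finiteDimensional_of_finite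
  have hfin : Module.finrank ℝ W = N := by rw [Module.finrank_eq_card_basis b, Fintype.card_fin]
  let A : W →ₗ[ℝ] W := b.constr ℝ fun j => (-ν j) • b j
  have hA : ∀ j, A (b j) = (-ν j) • b j := fun j => b.constr_basis ℝ _ j
  -- The graph of the operator is a linear subspace, so checking the eigenfunctions is enough.
  have hgraph : ∀ u : W, IsImage l V u (A u) := by
    let G : W →ₗ[ℝ] L2 × L2 := W.subtype.prod (W.subtype ∘ₗ A)
    have htop : (⊤ : Submodule ℝ W) ≤ (imageGraph hl hV).comap G := by
      rw [← b.span_eq, Submodule.span_le]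
      rintro _ ⟨j, rfl⟩
      change IsImage l V (b j) (A (b j))
      rw [hA, Submodule.coe_smul, hb]
      exact (he j).2
    exact fun u => htop (Submodule.mem_top (x := u))
  let e := (stdOrthonormalBasis ℝ W).reindex (finCongr hfin)
  refine ⟨fun j => e j, e.orthonormal.comp_linearIsometry W.subtypeₗᵢ,
    fun j => (hgraph (e j)).1, ?_⟩
  -- The trace is independent of the basis: an orthonormal basis gives the sum of the form, the
  -- eigenbasis gives the eigenvalues. The eigenfunctions themselves need not be orthogonal.
  have ht1 : LinearMap.trace ℝ W A = ∑ j, form l V (e j) (e j) := by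
    rw [LinearMap.trace_eq_sum_inner A e]
    refine Finset.sum_congr rfl fun j _ => ?_
    rw [(hgraph (e j)).2.2 _ (hgraph (e j)).1, ← inner_eq_integral, real_inner_comm]
    rfl
  have ht2 : LinearMap.trace ℝ W A = -∑ j, ν j := by
    rw [LinearMap.trace_eq_matrix_trace ℝ b, Matrix.trace, ← Finset.sum_neg_distrib]
    refine Finset.sum_congr rfl fun j _ => ?_
    rw [Matrix.diag_apply, LinearMap.toMatrix_apply, hA]
    simp
  rw [← ht1, ht2]

end Potential

end CircleLT

end

theorem theorem3p2 (l : ℕ) (hl : 1 ≤ l) :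
    -- the sharp constant `K(l)` exists and is positive
    (IsGreatest (CircleLT.admissible l) (CircleLT.K l) ∧ 0 < CircleLT.K l) ∧
    ∀ V : ℝ → ℝ, (∀ᵐ x ∂CircleLT.period, 0 ≤ V x) →
      MemLp V (ENNReal.ofReal ((2 * (l : ℝ) + 1) / (2 * (l : ℝ)))) CircleLT.period →
      -- `-ν j ≤ 0`, `j = 1, …, N`, are eigenvalues, repeated at most according to multiplicity
      ∀ (N : ℕ) (ν : Fin N → ℝ), (∀ j, 0 ≤ ν j) →
        (∃ φ : Fin N → CircleLT.L2, LinearIndependent ℝ φ ∧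
          ∀ j, CircleLT.IsEigenfunction l V (-ν j) (φ j)) →
        ((∑ j, ν j) + (N : ℝ) * (CircleLT.K l / CircleLT.c l) ^ (2 * l) ≤
          2 * (l : ℝ) / (2 * (l : ℝ) + 1) ^ ((2 * (l : ℝ) + 1) / (2 * (l : ℝ))) * CircleLT.c l
            * ∫ x in (0 : ℝ)..(2 * Real.pi), V x ^ ((2 * (l : ℝ) + 1) / (2 * (l : ℝ)))) ∧
        (l = 1 →
          (∑ j, ν j) + (N : ℝ) / Real.pi ^ 2 ≤
            2 / (3 * Real.sqrt 3) *
              ∫ x in (0 : ℝ)..(2 * Real.pi), V x ^ ((3 : ℝ) / 2)) := by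
  refine ⟨⟨CircleLT.isGreatest_K hl, CircleLT.K_pos hl⟩, ?_⟩
  rintro V hV0 hV N ν - ⟨φ, hφ, he⟩
  obtain ⟨ψ, ho, hψ, hsum⟩ :=
    CircleLT.exists_orthonormal_sum_form hl (CircleLT.integrable_potential hl hV) hφ he
  have h := CircleLT.sum_form_ge hl hV0 hV hψ ho
  rw [hsum, Fintype.card_fin] at h
  simp only [intervalIntegral.integral_of_le Real.two_pi_pos.le]
  have hmain : (∑ j, ν j) + (N : ℝ) * (CircleLT.K l / CircleLT.c l) ^ (2 * l) ≤
      2 * (l : ℝ) / (2 * (l : ℝ) + 1) ^ ((2 * (l : ℝ) + 1) / (2 * (l : ℝ))) * CircleLT.c l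
        * ∫ x in Set.Ioc 0 (2 * π), V x ^ ((2 * (l : ℝ) + 1) / (2 * (l : ℝ))) := by
    linarith
  refine ⟨hmain, ?_⟩
  rintro rfl
  -- For `l = 1`, `c = 1` and `K ≥ 1/π`, so `(K/c)²` may be replaced by `1/π²`.
  have hK : 1 / π ^ 2 ≤ CircleLT.K 1 ^ 2 := by
    rw [← one_div_pow]
    exact pow_le_pow_left₀ (by positivity) CircleLT.one_div_pi_le_K_one 2
  have hs : (3 : ℝ) ^ ((3 : ℝ) / 2) = 3 * √3 := by
    rw [show (3 : ℝ) / 2 = 1 + 1 / 2 by norm_num, rpow_add (by norm_num), rpow_one,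
      Real.sqrt_eq_rpow]
  rw [CircleLT.c_one, Nat.cast_one, show (2 : ℝ) * 1 + 1 = 3 by norm_num, mul_one, mul_one, div_one,
    mul_one, hs] at hmain
  refine le_trans ?_ hmain
  have : (N : ℝ) / π ^ 2 ≤ N * CircleLT.K 1 ^ 2 := by
    rw [div_eq_mul_one_div]
    gcongr
  linarith
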